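/- Let $d\ge 2$ and $k\ge 1$ be integers and put $Q^d:=[0,1)^d$. A cube is a set $a+[0,r)^d$ with $a\in\mathbb R^d$, $r>0$; $\mathcal D$ is the family of dyadic cubes $2^{-j}(Q^d+\alpha)$, $j\in\{0,1,2,\dots\}$, $\alpha\in\mathbb Z^d$, contained in $Q^d$; $\mathcal P_{k-1}$ is the space of real polynomials on $\mathbb R^d$ of total degree at most $k-1$. For $f\in L_q(Q^d)$ put $$E_k(f;Q;L_q):=\inf_{m\in\mathcal P_{k-1}}\|f-m\|_{L_q(Q)},\qquad |f|_{V_{pq}^k}:=\sup_\Delta\Bigl(\sum_{Q\in\Delta}E_k(f;Q;L_q)^p\Bigr)^{1/p},$$ where $\Delta$ runs over all families of pairwise disjoint cubes $Q\subset Q^d$, and let $V_{pq}^k$ be the space of all $f\in L_q(Q^d)$ with $|f|_{V_{pq}^k}<\infty$. There is a constant $c(k,d)>0$, depending only on $k$ and $d$, such that the following holds. Let $1\le p<q<\infty$ be such that $s:=d\left(\frac1p-\frac1q\right)$ satisfies $0<s\le k$, and let $f\in V_{pq}^k\cap C^\infty(\mathbb R^d)$ be real-valued with $|f|_{V_{pq}^k}=1$.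 Then for every integer $N\ge1$ there exist a finite family $\Delta_N\subset\mathcal D$ covering $Q^d$ and a function $g_N=\sum_{K\in\Delta_N}P_K\cdot 1_K$ with all $P_K\in\mathcal P_{k-1}$ such that $$\|f-g_N\|_{L_q(Q^d)}\le c(k,d)\,N^{-s/d}\qquad\text{and}\qquad \operatorname{card}\Delta_N\le c(d)\,N,\quad c(d):=2^{d+2}+9.$$ -/

import Mathlib

open MeasureTheory
open scoped ENNReal ContDiff

noncomputable section

namespace BVApprox

variable {d : ℕ}

/-- The half-open cube `a + [0, r)^d`. -/
def cube (a : Fin d → ℝ) (r : ℝ) : Set (Fin d → ℝ) :=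
  Set.univ.pi fun i => Set.Ico (a i) (a i + r)

/-- The half-open unit cube `[0,1)^d`. -/
def unitCube (d : ℕ) : Set (Fin d → ℝ) := cube 0 1

/-- A cube is a set homothetic to the half-open unit cube. -/
def IsCube (Q : Set (Fin d → ℝ)) : Prop :=
  ∃ (a : Fin d → ℝ) (r : ℝ), 0 < r ∧ Q = cube a r

/-- The dyadic subcubes `2^{-j}([0,1)^d + α)`, `j ∈ ℕ`, `α ∈ ℤ^d`, of the unit cube. -/
def dyadicCubes (d : ℕ) : Set (Set (Fin d → ℝ)) :=
  {K | K ⊆ unitCube d ∧ ∃ (j : ℕ) (α : Fin d → ℤ),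
    K = cube (fun i => (α i : ℝ) / 2 ^ j) (1 / 2 ^ j)}

/-- The polynomials in `d` real variables of (total) degree at most `l`. -/
def polys (d l : ℕ) : Submodule ℝ (MvPolynomial (Fin d) ℝ) :=
  MvPolynomial.restrictTotalDegree (Fin d) ℝ l

/-- The sums `∑_{K ∈ Δ} P_K · 1_K`, where each `P_K` is a polynomial of degree at most `l`. -/
def piecewisePolys (l : ℕ) (Δ : Finset (Set (Fin d → ℝ))) : Set ((Fin d → ℝ) → ℝ) :=
  {g | ∃ P : Set (Fin d → ℝ) → MvPolynomial (Fin d) ℝ,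
    (∀ K ∈ Δ, P K ∈ polys d l) ∧
    g = fun x => ∑ K ∈ Δ, K.indicator (fun y => MvPolynomial.eval y (P K)) x}

/-- The `L_q(S)` norm of `f` (with respect to Lebesgue measure), in `[0, ∞]`. -/
def LqNorm (f : (Fin d → ℝ) → ℝ) (S : Set (Fin d → ℝ)) (q : ℝ) : ℝ≥0∞ :=
  eLpNorm f (ENNReal.ofReal q) (volume.restrict S)

/-- The local best approximation `E_k(f; S; L_q)` by polynomials of degree `k - 1`
(meant for `1 ≤ k`). -/
def bestApprox (k : ℕ) (f : (Fin d → ℝ) → ℝ) (S : Set (Fin d → ℝ)) (q : ℝ) : ℝ≥0∞ :=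
  ⨅ m ∈ polys d (k - 1), LqNorm (fun x => f x - MvPolynomial.eval x m) S q

/-- The `(k,p)`-variation `var_p^k(f; S; L_q)`: the supremum, over all families `Δ` of pairwise
disjoint cubes contained in `S`, of `(∑_{Q ∈ Δ} E_k(f; Q; L_q)^p)^{1/p}`. -/
def variation (k : ℕ) (p q : ℝ) (f : (Fin d → ℝ) → ℝ) (S : Set (Fin d → ℝ)) : ℝ≥0∞ :=
  ⨆ (Δ : Set (Set (Fin d → ℝ))) (_ : ∀ Q ∈ Δ, IsCube Q ∧ Q ⊆ S) (_ : Δ.PairwiseDisjoint id),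
    (∑' Q : Δ, bestApprox k f (Q : Set (Fin d → ℝ)) q ^ p) ^ (1 / p)

/-- Membership in `V_{pq}^k([0,1)^d)`. -/
def MemV (k : ℕ) (p q : ℝ) (f : (Fin d → ℝ) → ℝ) : Prop :=
  MemLp f (ENNReal.ofReal q) (volume.restrict (unitCube d)) ∧
    variation k p q f (unitCube d) < ⊤

/-- The smoothness `s(V_{pq}^k) = d (1/p - 1/q)`. -/
def smoothness (d : ℕ) (p q : ℝ) : ℝ := d * (1 / p - 1 / q)

end BVApprox

end

namespace BVApprox

variable {d : ℕ}

/-! The supremum of `∑ E_k(f; Q; L_q)^p` over packings in a set `S` (`variationSum`) is a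
superadditive mass in `S`, at most 1 on the unit cube. It drives a greedy dyadic subdivision with
threshold `ε^p = A / N`. A light cube, of mass at most `ε^p`, takes one polynomial with error about
`ε`. A heavy cube `Q` cannot simply be halved, since its mass may stay in a single child for many
generations. Instead one descends to a deepest dyadic `Q' ⊆ Q` for which `Q \ Q'` is still light,
approximates on `Q \ Q'` with a bounded number `M` of pieces, and recurses into the children of
`Q'`. By maximality every child misses more than `ε^p` of the mass of `Q`. With `w` the mass divided
by `ε^p` and `B = M + 2^d`, induction then bounds the number of pieces by `max 1 (2Bw - B)`
(`sum_max_le`, `exists_approximable_dyadic`). The recursion stops at a level `J` where `f` itself is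
small in `L_q` on each cube. Taking `A = 2B` leaves at most `N` pieces, each contributing at most a
constant times `ε` to the `ℓ_q` sum of the errors, so the total error is of order `N^{1/q} ε`, that
is, `N^{1/q - 1/p}`.

The geometric core is `exists_approximable_dyadic_diff`: lightness gives good polynomials only on
cubes inside `Q \ Q'`, and boundedly many pieces must suffice however small `Q'` is. Between `Q'`
and `Q` lie the sets `D t`, each the triple of a dyadic ancestor of `Q'` intersected with `Q`. If `D
t ⊆ D t'` touch the same faces of `Q`, their difference is either thin in scale (at most one
generation) or thick in every direction where it is nonempty. In the thick case, as `d ≥ 2`,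
overlapping cubes connect it, and norm equivalence for polynomials merges the local approximants
into one polynomial `P`. The piece is `P` on `D t'` minus `P` on `D t`, a bounded number of dyadic
terms; this is why overlapping dyadic cubes are used. The touched faces change at most `2d` times.
-/

theorem measurableSet_cube (a : Fin d → ℝ) (r : ℝ) : MeasurableSet (cube a r) :=
  MeasurableSet.univ_pi fun _ => measurableSet_Ico

theorem mem_cube {a : Fin d → ℝ} {r : ℝ} {x : Fin d → ℝ} :
    x ∈ cube a r ↔ ∀ i, a i ≤ x i ∧ x i < a i + r := by
  simp [cube, Set.mem_pi]

theorem mem_polys {l : ℕ} {m : MvPolynomial (Fin d) ℝ} : m ∈ polys d l ↔ m.totalDegree ≤ l :=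
  MvPolynomial.mem_restrictTotalDegree _ _ _

theorem volume_cube (a : Fin d → ℝ) (r : ℝ) : volume (cube a r) = ENNReal.ofReal r ^ d := by
  simp [cube, volume_pi_pi]

/-! ### Norm equivalence and extrapolation for polynomials -/

/-- A polynomial that vanishes almost everywhere on the unit cube is zero. -/
theorem eq_zero_of_ae_unitCube {m : MvPolynomial (Fin d) ℝ}
    (h : (fun x => MvPolynomial.eval x m) =ᵐ[volume.restrict (cube (0 : Fin d → ℝ) 1)] 0) :
    m = 0 := by
  have hU : IsOpen (Set.univ.pi fun _ : Fin d => Set.Ioo (0 : ℝ) 1) :=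
    isOpen_set_pi Set.finite_univ fun _ _ => isOpen_Ioo
  have hsub : (Set.univ.pi fun _ : Fin d => Set.Ioo (0 : ℝ) 1) ⊆ cube 0 1 := by
    intro x hx
    rw [mem_cube]
    intro i
    have := hx i trivial
    simp only [Set.mem_Ioo] at this
    simpa using ⟨this.1.le, this.2⟩
  have h' : (fun x => MvPolynomial.eval x m) =ᵐ[volume.restrict
      (Set.univ.pi fun _ : Fin d => Set.Ioo (0 : ℝ) 1)] 0 :=
    ae_restrict_of_ae_restrict_of_subset hsub h
  have h0 : Set.EqOn (fun x => MvPolynomial.eval x m) 0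
      (Set.univ.pi fun _ : Fin d => Set.Ioo (0 : ℝ) 1) :=
    Measure.eqOn_open_of_ae_eq h' hU (MvPolynomial.continuous_eval m).continuousOn
      continuousOn_const
  refine MvPolynomial.funext_set (fun _ => Set.Ioo (0 : ℝ) 1)
    (fun _ => Set.Ioo_infinite one_pos) fun x hx => ?_
  simpa using h0 hx

theorem memLp_eval_unitCube (m : MvPolynomial (Fin d) ℝ) (p : ℝ≥0∞) :
    MemLp (fun x => MvPolynomial.eval x m) p (volume.restrict (cube (0 : Fin d → ℝ) 1)) := by
  have hK : IsCompact (Set.Icc (0 : Fin d → ℝ) 1) := isCompact_Icc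
  have hsub : cube (0 : Fin d → ℝ) 1 ⊆ Set.Icc 0 1 := by
    intro x hx
    rw [mem_cube] at hx
    exact ⟨fun i => (hx i).1, fun i => by simpa using (hx i).2.le⟩
  obtain ⟨c, hc⟩ := hK.exists_bound_of_continuousOn
    (MvPolynomial.continuous_eval m).continuousOn
  have : IsFiniteMeasure (volume.restrict (cube (0 : Fin d → ℝ) 1)) :=
    ⟨by simp [volume_cube]⟩
  refine MemLp.of_bound (MvPolynomial.continuous_eval m).aestronglyMeasurable c ?_
  filter_upwards [ae_restrict_mem (measurableSet_cube _ _)] with x hx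
  exact hc x (hsub hx)

/-- On a large cube, polynomials of bounded degree are controlled by their integral over the
unit cube. -/
theorem exists_enorm_eval_le (d l : ℕ) (Λ : ℝ) :
    ∃ C : NNReal, ∀ m ∈ polys d l, ∀ x : Fin d → ℝ, (∀ i, |x i| ≤ Λ) →
      ‖MvPolynomial.eval x m‖ₑ ≤
        C * eLpNorm (fun y => MvPolynomial.eval y m) 1 (volume.restrict (cube 0 1)) := by
  have : Module.Finite ℝ (polys d l) := by unfold polys; infer_instance
  set μ : Measure (Fin d → ℝ) := volume.restrict (cube 0 1) with hμ
  have : Fact ((1 : ℝ≥0∞) ≤ 1) := ⟨le_rfl⟩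
  let T : polys d l →ₗ[ℝ] Lp ℝ 1 μ :=
    { toFun := fun m => (memLp_eval_unitCube m.1 1).toLp _
      map_add' := fun a b => by
        rw [← MemLp.toLp_add]
        congr 1
        ext x; simp
      map_smul' := fun c a => by
        rw [RingHom.id_apply, ← MemLp.toLp_const_smul]
        congr 1
        ext x; simp [MvPolynomial.smul_eval] }
  have hT : Function.Injective T := by
    rw [← LinearMap.ker_eq_bot, LinearMap.ker_eq_bot']
    intro m hm
    have h1 : (memLp_eval_unitCube m.1 1).toLp _ = (0 : Lp ℝ 1 μ) := hm
    have h2 := (memLp_eval_unitCube m.1 1).coeFn_toLp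
    rw [h1] at h2
    exact Subtype.ext (eq_zero_of_ae_unitCube (h2.symm.trans (Lp.coeFn_zero ℝ 1 μ)))
  let K : Set (Fin d → ℝ) := Set.Icc (fun _ => -Λ) (fun _ => Λ)
  have : CompactSpace K := isCompact_iff_compactSpace.1 isCompact_Icc
  let S : polys d l →ₗ[ℝ] C(K, ℝ) :=
    { toFun := fun m => ⟨fun x => MvPolynomial.eval x.1 m.1,
        (MvPolynomial.continuous_eval m.1).comp continuous_subtype_val⟩
      map_add' := fun a b => by ext x; simp
      map_smul' := fun c a => by ext x; simp [MvPolynomial.smul_eval] }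
  -- The passage from the image in `L_1` back to continuous functions on `K` is linear on a
  -- finite-dimensional space, hence bounded; its norm is the constant.
  let e := LinearEquiv.ofInjective T hT
  let Φ : LinearMap.range T →L[ℝ] C(K, ℝ) :=
    LinearMap.toContinuousLinearMap (S ∘ₗ e.symm.toLinearMap)
  refine ⟨‖Φ‖₊, fun m hm x hx => ?_⟩
  have hxK : x ∈ K := ⟨fun i => (abs_le.1 (hx i)).1, fun i => (abs_le.1 (hx i)).2⟩
  have h1 : ‖S ⟨m, hm⟩‖ ≤ ‖Φ‖ * ‖T ⟨m, hm⟩‖ := by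
    have := Φ.le_opNorm (e ⟨m, hm⟩)
    simpa [Φ, e] using this
  have h2 : ‖MvPolynomial.eval x m‖ ≤ ‖S ⟨m, hm⟩‖ :=
    (S ⟨m, hm⟩).norm_coe_le_norm ⟨x, hxK⟩
  have h3 : ‖T ⟨m, hm⟩‖ₑ = eLpNorm (fun y => MvPolynomial.eval y m) 1 μ :=
    Lp.enorm_toLp (memLp_eval_unitCube m 1)
  rw [← h3]
  have h4 : ‖MvPolynomial.eval x m‖₊ ≤ ‖Φ‖₊ * ‖T ⟨m, hm⟩‖₊ := h2.trans h1
  have h5 : (‖MvPolynomial.eval x m‖₊ : ℝ≥0∞) ≤ ((‖Φ‖₊ * ‖T ⟨m, hm⟩‖₊ : NNReal) : ℝ≥0∞) :=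
    ENNReal.coe_le_coe.2 h4
  rw [ENNReal.coe_mul] at h5
  exact h5

/-- Composition of a polynomial with the homothety `y ↦ b + ρ y`. -/
noncomputable def homothetyPoly (b : Fin d → ℝ) (ρ : ℝ) (m : MvPolynomial (Fin d) ℝ) :
    MvPolynomial (Fin d) ℝ :=
  MvPolynomial.bind₁ (fun i => MvPolynomial.C (b i) + MvPolynomial.C ρ * MvPolynomial.X i) m

theorem eval_homothetyPoly (b : Fin d → ℝ) (ρ : ℝ) (m : MvPolynomial (Fin d) ℝ)
    (y : Fin d → ℝ) :
    MvPolynomial.eval y (homothetyPoly b ρ m) = MvPolynomial.eval (b + ρ • y) m := by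
  unfold homothetyPoly
  rw [← MvPolynomial.aeval_eq_eval, MvPolynomial.aeval_bind₁, MvPolynomial.aeval_eq_eval]
  congr 1
  simp [MvPolynomial.aeval_eq_eval]
  rfl

theorem homothetyPoly_mem {l : ℕ} (b : Fin d → ℝ) (ρ : ℝ) {m : MvPolynomial (Fin d) ℝ}
    (hm : m ∈ polys d l) : homothetyPoly b ρ m ∈ polys d l := by
  rw [mem_polys] at hm ⊢
  unfold homothetyPoly
  rw [MvPolynomial.bind₁, MvPolynomial.aeval_def, MvPolynomial.eval₂_eq]
  refine MvPolynomial.totalDegree_finsetSum_le fun s hs => ?_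
  refine (MvPolynomial.totalDegree_mul _ _).trans ?_
  have h1 : (algebraMap ℝ (MvPolynomial (Fin d) ℝ) (m.coeff s)).totalDegree = 0 :=
    MvPolynomial.totalDegree_C _
  rw [h1, zero_add]
  refine (MvPolynomial.totalDegree_finsetProd _ _).trans ?_
  have h2 : (s.sum fun _ e => e) ≤ l := (MvPolynomial.le_totalDegree hs).trans hm
  refine le_trans ?_ h2
  refine Finset.sum_le_sum fun i _ => ?_
  refine (MvPolynomial.totalDegree_pow _ _).trans ?_
  have h3 : (MvPolynomial.C (b i) + MvPolynomial.C ρ * MvPolynomial.X i :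
      MvPolynomial (Fin d) ℝ).totalDegree ≤ 1 := by
    refine (MvPolynomial.totalDegree_add _ _).trans ?_
    rw [MvPolynomial.totalDegree_C]
    refine max_le (zero_le_one) ((MvPolynomial.totalDegree_mul _ _).trans ?_)
    rw [MvPolynomial.totalDegree_C, MvPolynomial.totalDegree_X]
  calc s i * _ ≤ s i * 1 := Nat.mul_le_mul_left _ h3
    _ = s i := mul_one _

theorem continuous_homothety (b : Fin d → ℝ) (ρ : ℝ) :
    Continuous fun y : Fin d → ℝ => b + ρ • y := by fun_prop

theorem volume_eq_smul_map_homothety (b : Fin d → ℝ) {ρ : ℝ} (hρ : 0 < ρ) :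
    (volume : Measure (Fin d → ℝ)) =
      ENNReal.ofReal (ρ ^ d) • Measure.map (fun y => b + ρ • y) volume := by
  have h1 : Measure.map (fun y : Fin d → ℝ => b + ρ • y) volume =
      Measure.map (fun z => b + z) (Measure.map (fun y => ρ • y) volume) := by
    rw [Measure.map_map (measurable_const_add b) (measurable_const_smul ρ)]
    rfl
  have h2 : Measure.map (fun y : Fin d → ℝ => ρ • y) volume =
      ENNReal.ofReal |(ρ ^ d)⁻¹| • volume := by
    have := Measure.map_addHaar_smul (volume : Measure (Fin d → ℝ)) hρ.ne'
    simpa using this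
  rw [h1, h2, Measure.map_smul, map_add_left_eq_self, smul_smul, ← ENNReal.ofReal_mul (by positivity),
    abs_of_pos (by positivity), mul_inv_cancel₀ (by positivity), ENNReal.ofReal_one, one_smul]

theorem LqNorm_homothety (b : Fin d → ℝ) {ρ : ℝ} (hρ : 0 < ρ) {h : (Fin d → ℝ) → ℝ}
    (hh : Continuous h) {S : Set (Fin d → ℝ)} (hS : MeasurableSet S) {q : ℝ} (hq : 1 ≤ q) :
    LqNorm h S q = ENNReal.ofReal (ρ ^ d) ^ (1 / q) *
      LqNorm (fun y => h (b + ρ • y)) ((fun y => b + ρ • y) ⁻¹' S) q := by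
  have hc := continuous_homothety b ρ
  have h1 : volume.restrict S = ENNReal.ofReal (ρ ^ d) • Measure.map (fun y => b + ρ • y)
      (volume.restrict ((fun y => b + ρ • y) ⁻¹' S)) := by
    conv_lhs => rw [volume_eq_smul_map_homothety b hρ]
    rw [Measure.restrict_smul, Measure.restrict_map hc.measurable hS]
  have hq0 : 0 < q := by linarith
  unfold LqNorm
  rw [h1, eLpNorm_smul_measure_of_ne_top (by simp),
    eLpNorm_map_measure hh.aestronglyMeasurable hc.aemeasurable]
  rw [ENNReal.toReal_div, ENNReal.toReal_ofReal hq0.le]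
  rfl

/-- Extrapolation: the `L_q` norm of a polynomial over the neighbourhood of radius `Λ ρ` of a
cube of side `ρ` is controlled, uniformly in `q`, by its `L_q` norm over the cube. -/
theorem exists_LqNorm_eval_le (d l : ℕ) {Λ : ℝ} (hΛ : 1 ≤ Λ) :
    ∃ C : NNReal, ∀ q : ℝ, 1 ≤ q → ∀ m ∈ polys d l, ∀ (b : Fin d → ℝ) (ρ : ℝ), 0 < ρ →
      ∀ Z : Set (Fin d → ℝ), (∀ x ∈ Z, ∀ i, |x i - b i| ≤ Λ * ρ) →
      LqNorm (fun x => MvPolynomial.eval x m) Z q ≤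
        C * LqNorm (fun x => MvPolynomial.eval x m) (cube b ρ) q := by
  obtain ⟨C, hC⟩ := exists_enorm_eval_le d l Λ
  refine ⟨C * (2 * Λ).toNNReal ^ d, fun q hq m hm b ρ hρ Z hZ => ?_⟩
  have hq0 : 0 < q := by linarith
  set B : Set (Fin d → ℝ) := Set.Icc (fun i => b i - Λ * ρ) (fun i => b i + Λ * ρ) with hB
  have hZB : Z ⊆ B := fun x hx =>
    ⟨fun i => by have := abs_le.1 (hZ x hx i); simp only; linarith,
     fun i => by have := abs_le.1 (hZ x hx i); simp only; linarith⟩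
  refine (eLpNorm_mono_measure _ (Measure.restrict_mono hZB le_rfl)).trans ?_
  change LqNorm _ B q ≤ _
  have hcont := MvPolynomial.continuous_eval m
  rw [LqNorm_homothety b hρ hcont measurableSet_Icc hq,
    LqNorm_homothety b hρ hcont (measurableSet_cube b ρ) hq, mul_left_comm]
  gcongr
  have hpre : (fun y => b + ρ • y) ⁻¹' cube b ρ = cube 0 1 := by
    ext y
    simp only [Set.mem_preimage, mem_cube, Pi.add_apply, Pi.smul_apply, smul_eq_mul,
      Pi.zero_apply, zero_add]
    refine forall_congr' fun i => and_congr ?_ ?_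
    · rw [le_add_iff_nonneg_right, mul_nonneg_iff_of_pos_left hρ]
    · rw [add_lt_add_iff_left, mul_lt_iff_lt_one_right hρ]
  have hpre2 : (fun y => b + ρ • y) ⁻¹' B = Set.Icc (fun _ => -Λ) (fun _ => Λ) := by
    ext y
    simp only [hB, Set.mem_preimage, Set.mem_Icc, Pi.le_def, Pi.add_apply, Pi.smul_apply,
      smul_eq_mul]
    refine and_congr (forall_congr' fun i => ?_) (forall_congr' fun i => ?_)
    · rw [sub_eq_add_neg, add_le_add_iff_left, ← neg_mul, mul_comm, mul_le_mul_iff_right₀ hρ]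
    · rw [add_le_add_iff_left, mul_comm Λ, mul_le_mul_iff_right₀ hρ]
  rw [hpre, hpre2]
  have hm' := homothetyPoly_mem b ρ hm
  have heq : (fun y => MvPolynomial.eval (b + ρ • y) m) =
      fun y => MvPolynomial.eval y (homothetyPoly b ρ m) := by
    ext y; rw [eval_homothetyPoly]
  rw [heq]
  -- Uniformity in `q` has two sources: `L_1 ≤ L_q` on a probability space, and below, the volume of
  -- the large cube is at least 1, so its power `1/q` is at most the volume itself.
  have hprob : IsProbabilityMeasure (volume.restrict (cube (0 : Fin d → ℝ) 1)) :=
    ⟨by simp [volume_cube]⟩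
  have hq1 : (1 : ℝ≥0∞) ≤ ENNReal.ofReal q := by simpa using hq
  have h1 : eLpNorm (fun y => MvPolynomial.eval y (homothetyPoly b ρ m)) 1
      (volume.restrict (cube 0 1)) ≤
      LqNorm (fun y => MvPolynomial.eval y (homothetyPoly b ρ m)) (cube 0 1) q :=
    eLpNorm_le_eLpNorm_of_exponent_le hq1
      (MvPolynomial.continuous_eval _).aestronglyMeasurable
  set X := LqNorm (fun y => MvPolynomial.eval y (homothetyPoly b ρ m)) (cube 0 1) q
  have h2 : ∀ᵐ x ∂(volume.restrict (Set.Icc (fun _ : Fin d => -Λ) (fun _ => Λ))),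
      ‖MvPolynomial.eval x (homothetyPoly b ρ m)‖ₑ ≤ C * X := by
    filter_upwards [ae_restrict_mem measurableSet_Icc] with x hx
    refine (hC _ hm' x fun i => abs_le.2 ⟨hx.1 i, hx.2 i⟩).trans ?_
    gcongr
  refine (eLpNorm_le_of_ae_enorm_bound h2).trans ?_
  have hvol : volume (Set.Icc (fun _ : Fin d => -Λ) (fun _ => Λ)) =
      (((2 * Λ).toNNReal ^ d : NNReal) : ℝ≥0∞) := by
    rw [Real.volume_Icc_pi]
    simp only [sub_neg_eq_add, Finset.prod_const, Finset.card_univ, Fintype.card_fin, ← two_mul]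
    rw [ENNReal.coe_pow]; rfl
  rw [Measure.restrict_apply_univ, hvol, smul_eq_mul, ENNReal.toReal_ofReal hq0.le]
  have h3 : ((((2 * Λ).toNNReal ^ d : NNReal) : ℝ≥0∞)) ^ q⁻¹ ≤ ((2 * Λ).toNNReal ^ d : NNReal) := by
    refine (ENNReal.rpow_le_rpow_of_exponent_le ?_ ((inv_le_one₀ hq0).2 hq)).trans_eq
      (ENNReal.rpow_one _)
    have : (1 : NNReal) ≤ (2 * Λ).toNNReal := by
      rw [Real.one_le_toNNReal]; linarith
    exact_mod_cast one_le_pow₀ this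
  calc _ ≤ (C * X) * (((2 * Λ).toNNReal ^ d : NNReal) : ℝ≥0∞) := by gcongr
    _ = _ := by push_cast; ring

/-! ### Gluing local approximants in `L_q` -/

theorem LqNorm_mono {h : (Fin d → ℝ) → ℝ} {S T : Set (Fin d → ℝ)} (q : ℝ) (hST : S ⊆ T) :
    LqNorm h S q ≤ LqNorm h T q :=
  eLpNorm_mono_measure _ (Measure.restrict_mono hST le_rfl)

theorem LqNorm_add_le {h₁ h₂ : (Fin d → ℝ) → ℝ} (c₁ : Continuous h₁) (c₂ : Continuous h₂)
    (S : Set (Fin d → ℝ)) {q : ℝ} (hq : 1 ≤ q) :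
    LqNorm (fun x => h₁ x + h₂ x) S q ≤ LqNorm h₁ S q + LqNorm h₂ S q :=
  eLpNorm_add_le c₁.aestronglyMeasurable c₂.aestronglyMeasurable (by simpa using hq)

theorem LqNorm_rpow {q : ℝ} (hq : 1 ≤ q) (h : (Fin d → ℝ) → ℝ) (S : Set (Fin d → ℝ)) :
    LqNorm h S q ^ q = ∫⁻ x in S, ‖h x‖ₑ ^ q := by
  have hq0 : 0 < q := by linarith
  unfold LqNorm
  rw [eLpNorm_eq_lintegral_rpow_enorm_toReal (by simpa using hq0) ENNReal.ofReal_ne_top,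
    ENNReal.toReal_ofReal hq0.le, ← ENNReal.rpow_mul, one_div_mul_cancel hq0.ne',
    ENNReal.rpow_one]

theorem LqNorm_union_le {q : ℝ} (hq : 1 ≤ q) (h : (Fin d → ℝ) → ℝ)
    (S T : Set (Fin d → ℝ)) :
    LqNorm h (S ∪ T) q ≤ LqNorm h S q + LqNorm h T q := by
  have hq0 : 0 < q := by linarith
  rw [← ENNReal.rpow_le_rpow_iff hq0, LqNorm_rpow hq]
  calc _ ≤ (∫⁻ x in S, ‖h x‖ₑ ^ q) + ∫⁻ x in T, ‖h x‖ₑ ^ q := lintegral_union_le _ _ _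
    _ = LqNorm h S q ^ q + LqNorm h T q ^ q := by rw [LqNorm_rpow hq, LqNorm_rpow hq]
    _ ≤ _ := ENNReal.add_rpow_le_rpow_add _ _ hq

theorem LqNorm_empty (h : (Fin d → ℝ) → ℝ) (q : ℝ) : LqNorm h ∅ q = 0 := by
  simp [LqNorm]

theorem LqNorm_biUnion_le {q : ℝ} (hq : 1 ≤ q) (h : (Fin d → ℝ) → ℝ) {ι : Type*}
    (s : Finset ι) (S : ι → Set (Fin d → ℝ)) :
    LqNorm h (⋃ i ∈ s, S i) q ≤ ∑ i ∈ s, LqNorm h (S i) q := by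
  classical
  induction s using Finset.induction_on with
  | empty => simp [LqNorm_empty]
  | insert a s ha ih =>
    rw [Finset.set_biUnion_insert, Finset.sum_insert ha]
    exact (LqNorm_union_le hq h _ _).trans (by gcongr)

/-- A polynomial close to `f` on a set `S` is close to `f` on a neighbouring set `S'` as soon as
`f` is close to some polynomial on `S'`. -/
theorem exists_LqNorm_glue (d l : ℕ) {Λ : ℝ} (hΛ : 1 ≤ Λ) :
    ∃ C : NNReal, 1 ≤ C ∧ ∀ q : ℝ, 1 ≤ q → ∀ f : (Fin d → ℝ) → ℝ, Continuous f →
      ∀ P ∈ polys d l, ∀ P' ∈ polys d l, ∀ (b : Fin d → ℝ) (ρ : ℝ), 0 < ρ →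
      ∀ S S' : Set (Fin d → ℝ), cube b ρ ⊆ S → cube b ρ ⊆ S' →
      (∀ x ∈ S', ∀ i, |x i - b i| ≤ Λ * ρ) →
      LqNorm (fun x => f x - MvPolynomial.eval x P) S' q ≤
        C * (LqNorm (fun x => f x - MvPolynomial.eval x P) S q +
          LqNorm (fun x => f x - MvPolynomial.eval x P') S' q) := by
  obtain ⟨C, hC⟩ := exists_LqNorm_eval_le d l hΛ
  refine ⟨C + 1, by simp, fun q hq f hf P hP P' hP' b ρ hρ S S' hS hS' hfar => ?_⟩
  have hcP : Continuous fun x => f x - MvPolynomial.eval x P :=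
    hf.sub (MvPolynomial.continuous_eval P)
  have hcP' : Continuous fun x => f x - MvPolynomial.eval x P' :=
    hf.sub (MvPolynomial.continuous_eval P')
  set e := LqNorm (fun x => f x - MvPolynomial.eval x P) S q
  set e' := LqNorm (fun x => f x - MvPolynomial.eval x P') S' q
  -- `P' - P` is small on the common cube because both polynomials are close to `f` there;
  -- extrapolation carries this to all of `S'`.
  have h1 : LqNorm (fun x => MvPolynomial.eval x (P' - P)) (cube b ρ) q ≤ e + e' := by
    have : (fun x => MvPolynomial.eval x (P' - P)) = fun x =>
        (f x - MvPolynomial.eval x P) + -(f x - MvPolynomial.eval x P') := by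
      ext x; rw [map_sub]; ring
    rw [this]
    refine (LqNorm_add_le hcP hcP'.neg _ hq).trans (add_le_add (LqNorm_mono q hS) ?_)
    have hneg : LqNorm (fun x => -(f x - MvPolynomial.eval x P')) (cube b ρ) q =
        LqNorm (fun x => (f x - MvPolynomial.eval x P')) (cube b ρ) q :=
      eLpNorm_neg (fun x => f x - MvPolynomial.eval x P') _ _
    exact hneg.le.trans (LqNorm_mono q hS')
  have h2 := hC q hq (P' - P) (Submodule.sub_mem _ hP' hP) b ρ hρ S' hfar
  have h3 : (fun x => f x - MvPolynomial.eval x P) = fun x =>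
      (f x - MvPolynomial.eval x P') + MvPolynomial.eval x (P' - P) := by
    ext x; rw [map_sub]; ring
  calc LqNorm (fun x => f x - MvPolynomial.eval x P) S' q
      ≤ e' + LqNorm (fun x => MvPolynomial.eval x (P' - P)) S' q := by
        rw [h3]; exact LqNorm_add_le hcP' (MvPolynomial.continuous_eval _) _ hq
    _ ≤ (e + e') + C * (e + e') := by
        gcongr
        · exact le_add_self
        · exact h2.trans (by gcongr)
    _ = _ := by push_cast; ring

/-! ### One polynomial on a box or on a difference of boxes -/

/-- The half-open box `∏ [A i, B i)`. -/
def box (A B : Fin d → ℝ) : Set (Fin d → ℝ) := Set.univ.pi fun i => Set.Ico (A i) (B i)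

theorem mem_box {A B x : Fin d → ℝ} : x ∈ box A B ↔ ∀ i, A i ≤ x i ∧ x i < B i := by
  simp [box, Set.mem_pi]

theorem measurableSet_box (A B : Fin d → ℝ) : MeasurableSet (box A B) :=
  MeasurableSet.univ_pi fun _ => measurableSet_Ico

theorem cube_subset_box {a A B : Fin d → ℝ} {r : ℝ} (h : ∀ i, A i ≤ a i ∧ a i + r ≤ B i) :
    cube a r ⊆ box A B := by
  intro x hx
  rw [mem_cube] at hx
  rw [mem_box]
  intro i
  have h1 := h i
  have h2 := hx i
  constructor <;> linarith

/-- `f` is approximable with accuracy `e` by polynomials of degree at most `l` on every cube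
contained in `S`. -/
def LocallyApproximable (l : ℕ) (q : ℝ) (f : (Fin d → ℝ) → ℝ) (e : ℝ≥0∞)
    (S : Set (Fin d → ℝ)) : Prop :=
  ∀ (a : Fin d → ℝ) (r : ℝ), 0 < r → cube a r ⊆ S →
    ∃ m ∈ polys d l, LqNorm (fun x => f x - MvPolynomial.eval x m) (cube a r) q ≤ e

theorem LocallyApproximable.mono {l : ℕ} {q : ℝ} {f : (Fin d → ℝ) → ℝ} {e : ℝ≥0∞}
    {S T : Set (Fin d → ℝ)} (h : LocallyApproximable l q f e T) (hST : S ⊆ T) :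
    LocallyApproximable l q f e S :=
  fun a r hr hs => h a r hr (hs.trans hST)

/-- Grid cubes of side `r` are pushed back by the `min` so that they do not stick out of the box; at
most 13 positions occur per axis. -/
theorem box_subset_iUnion_cube {A B : Fin d → ℝ} {r : ℝ} (hr : 0 < r)
    (h2 : ∀ i, B i ≤ A i + 12 * r) :
    box A B ⊆ ⋃ n ∈ (Finset.univ : Finset (Fin d → Fin 13)),
      cube (fun i => min (A i + (n i : ℕ) * r) (B i - r)) r := by
  intro x hx
  rw [mem_box] at hx
  have hfl : ∀ i, 0 ≤ (x i - A i) / r := fun i => div_nonneg (by linarith [(hx i).1]) hr.le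
  have hlt : ∀ i, ⌊(x i - A i) / r⌋₊ < 13 := by
    intro i
    rw [Nat.floor_lt (hfl i), div_lt_iff₀ hr]
    have := h2 i
    have := (hx i).2
    push_cast
    linarith
  simp only [Finset.mem_univ, Set.iUnion_true, Set.mem_iUnion]
  refine ⟨fun i => ⟨⌊(x i - A i) / r⌋₊, hlt i⟩, ?_⟩
  rw [mem_cube]
  intro i
  have e1 := Nat.floor_le (hfl i)
  have e2 := Nat.lt_floor_add_one ((x i - A i) / r)
  rw [le_div_iff₀ hr] at e1
  rw [div_lt_iff₀ hr] at e2
  simp only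
  refine ⟨(min_le_left _ _).trans (by linarith), ?_⟩
  rcases min_choice (A i + (⌊(x i - A i) / r⌋₊ : ℝ) * r) (B i - r) with h | h
  · rw [h]; linarith
  · rw [h]; linarith [(hx i).2]

/-- Local approximability on a box of bounded eccentricity yields a single approximating
polynomial. -/
theorem exists_poly_box (d l : ℕ) :
    ∃ C : NNReal, ∀ q : ℝ, 1 ≤ q → ∀ f : (Fin d → ℝ) → ℝ, Continuous f →
      ∀ (e : ℝ≥0∞) (r : ℝ), 0 < r → ∀ A B : Fin d → ℝ,
      (∀ i, A i + r ≤ B i) → (∀ i, B i ≤ A i + 12 * r) →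
      LocallyApproximable l q f e (box A B) →
      ∃ P ∈ polys d l, LqNorm (fun x => f x - MvPolynomial.eval x P) (box A B) q ≤ C * e := by
  obtain ⟨C, -, hC⟩ := exists_LqNorm_glue d l (Λ := 4) (by norm_num)
  obtain ⟨c, hc0, hcs⟩ : ∃ c : ℕ → NNReal, c 0 = 1 ∧ ∀ n, c (n + 1) = C * (c n + 1) :=
    ⟨fun n => Nat.rec 1 (fun _ x => C * (x + 1)) n, rfl, fun _ => rfl⟩
  refine ⟨13 ^ d * c 24, fun q hq f hf e r hr A B h1 h2 hloc => ?_⟩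
  have hA : cube A r ⊆ box A B := cube_subset_box fun i => ⟨le_rfl, h1 i⟩
  obtain ⟨P, hP, hPe⟩ := hloc A r hr hA
  refine ⟨P, hP, ?_⟩
  have key : ∀ a : Fin d → ℝ, (∀ i, A i ≤ a i ∧ a i + r ≤ B i) →
      LqNorm (fun x => f x - MvPolynomial.eval x P) (cube a r) q ≤ c 24 * e := by
    intro a ha
    -- The cube slides from the corner `A` to `a` in 24 steps. Since `a i - A i ≤ 11 r`, each step
    -- is shorter than `r / 2`, so consecutive cubes share a cube of side `r / 2`, across which the
    -- polynomial of the corner is propagated.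
    let γ : ℕ → Fin d → ℝ := fun n i => A i + (n / 24 : ℝ) * (a i - A i)
    have hγ : ∀ n ≤ 24, LqNorm (fun x => f x - MvPolynomial.eval x P) (cube (γ n) r) q ≤
        c n * e := by
      intro n
      induction n with
      | zero =>
        intro _
        have : γ 0 = A := by ext i; simp [γ]
        rw [this]
        simpa [hc0] using hPe
      | succ n ih =>
        intro hn
        have hn' : (n + 1 : ℝ) ≤ 24 := by exact_mod_cast hn
        have hcube : cube (γ (n + 1)) r ⊆ box A B := by
          refine cube_subset_box fun i => ?_
          have h3 := ha i
          have h4 : (0 : ℝ) ≤ (n + 1 : ℝ) / 24 := by positivity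
          have h5 : (n + 1 : ℝ) / 24 ≤ 1 := by rw [div_le_one (by norm_num)]; exact hn'
          have h6 : 0 ≤ a i - A i := by linarith
          simp only [γ]
          push_cast
          constructor
          · nlinarith
          · nlinarith
        obtain ⟨P', hP', hPe'⟩ := hloc _ r hr hcube
        have hstep : ∀ i, γ n i ≤ γ (n + 1) i ∧ γ (n + 1) i ≤ γ n i + r / 2 := by
          intro i
          have h3 := ha i
          have h4 := h2 i
          have h5 : γ (n + 1) i = γ n i + (a i - A i) / 24 := by
            simp only [γ]; push_cast; ring
          rw [h5]
          constructor <;> linarith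
        have hs : cube (γ (n + 1)) (r / 2) ⊆ cube (γ n) r := by
          refine cube_subset_box fun i => ?_
          have := hstep i
          constructor <;> linarith
        have hs' : cube (γ (n + 1)) (r / 2) ⊆ cube (γ (n + 1)) r :=
          cube_subset_box fun i => by constructor <;> linarith
        refine (hC q hq f hf P hP P' hP' (γ (n + 1)) (r / 2) (by positivity) _ _ hs hs'
          ?_).trans ?_
        · intro x hx i
          rw [mem_cube] at hx
          have := hx i
          rw [abs_le]
          constructor <;> linarith
        · calc _ ≤ C * (c n * e + e) := by
                gcongr
                exact ih (by omega)
            _ = (C * (c n + 1) : NNReal) * e := by push_cast; ring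
            _ = _ := by rw [hcs]
    have : γ 24 = a := by ext i; simp [γ]
    rw [← this]
    exact hγ 24 le_rfl
  refine (LqNorm_mono q (box_subset_iUnion_cube hr h2)).trans ?_
  refine (LqNorm_biUnion_le hq _ _ _).trans ?_
  refine (Finset.sum_le_card_nsmul _ _ (c 24 * e) fun n _ => key _ fun i => ?_).trans ?_
  · have h3 := h1 i
    refine ⟨le_min (le_add_of_nonneg_right (by positivity)) (by linarith), ?_⟩
    linarith [min_le_right (A i + ((n i : ℕ) : ℝ) * r) (B i - r)]
  · simp [mul_assoc]

/-- Local approximability on the difference of two nested boxes, each face of the inner one being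
contained in a face of the outer one or far from it, yields a single approximating polynomial. -/
theorem exists_poly_box_diff (d l : ℕ) (hd : 2 ≤ d) :
    ∃ C : NNReal, 1 ≤ C ∧ ∀ q : ℝ, 1 ≤ q → ∀ f : (Fin d → ℝ) → ℝ, Continuous f →
      ∀ (e : ℝ≥0∞) (r : ℝ), 0 < r → ∀ A B A' B' : Fin d → ℝ,
      (∀ i, A i + 4 * r ≤ B i) → (∀ i, B i ≤ A i + 12 * r) →
      (∀ i, B' i ≤ A' i + 3 * r) → (∀ i, A' i < B' i) →
      (∀ i, A' i = A i ∨ A i + r ≤ A' i) → (∀ i, B' i = B i ∨ B' i + r ≤ B i) →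
      LocallyApproximable l q f e (box A B \ box A' B') →
      ∃ P ∈ polys d l,
        LqNorm (fun x => f x - MvPolynomial.eval x P) (box A B \ box A' B') q ≤ C * e := by
  classical
  obtain ⟨C, hC1, hC⟩ := exists_LqNorm_glue d l (Λ := 12) (by norm_num)
  obtain ⟨Cb, hCb⟩ := exists_poly_box d l
  refine ⟨2 * d * (C * (C * (Cb + Cb) + Cb)) + 1, by simp,
    fun q hq f hf e r hr A B A' B' h1 h2 h3 h4 hA hB hloc => ?_⟩
  -- The slabs of the outer box cut by two hyperplanes orthogonal to axis `c`. `Far` says that the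
  -- slab has width at least `r` and lies on one side of the inner box.
  let slab : Fin d → ℝ → ℝ → Set (Fin d → ℝ) := fun c α β =>
    box (Function.update A c α) (Function.update B c β)
  let Far : Fin d → ℝ → ℝ → Prop := fun c α β =>
    A c ≤ α ∧ α + r ≤ β ∧ β ≤ B c ∧ (β ≤ A' c ∨ B' c ≤ α)
  have hslab : ∀ c α β, Far c α β → slab c α β ⊆ box A B \ box A' B' := by
    intro c α β ⟨f1, f2, f3, f4⟩ x hx
    rw [mem_box] at hx
    refine ⟨mem_box.2 fun i => ?_, fun hx' => ?_⟩
    · have hi := hx i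
      by_cases hic : i = c
      · subst hic
        simp only [Function.update_self] at hi
        constructor <;> linarith
      · simpa [Function.update_of_ne hic] using hi
    · have hc := hx c
      have hc' := mem_box.1 hx' c
      simp only [Function.update_self] at hc
      rcases f4 with f4 | f4 <;> linarith
  have hpoly : ∀ c α β, Far c α β → ∃ P ∈ polys d l,
      LqNorm (fun x => f x - MvPolynomial.eval x P) (slab c α β) q ≤ Cb * e := by
    intro c α β hF
    refine hCb q hq f hf e r hr _ _ ?_ ?_ (hloc.mono (hslab c α β hF))
    all_goals
      intro i
      obtain ⟨f1, f2, f3, f4⟩ := hF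
      have := h1 i
      have := h2 i
      by_cases hic : i = c
      · subst hic
        simp only [Function.update_self]
        linarith
      · simp only [Function.update_of_ne hic]
        linarith
  have hglue : ∀ c α β c' α' β', c ≠ c' → Far c α β → Far c' α' β' →
      ∀ P ∈ polys d l, ∀ P' ∈ polys d l,
      LqNorm (fun x => f x - MvPolynomial.eval x P) (slab c' α' β') q ≤
        C * (LqNorm (fun x => f x - MvPolynomial.eval x P) (slab c α β) q +
          LqNorm (fun x => f x - MvPolynomial.eval x P') (slab c' α' β') q) := by
    intro c α β c' α' β' hcc hF hF' P hP P' hP'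
    have hF1 := hF
    have hF1' := hF'
    obtain ⟨f1, f2, f3, f4⟩ := hF1
    obtain ⟨g1, g2, g3, g4⟩ := hF1'
    -- Slabs orthogonal to two different axes always meet in a cube of side `r`, with this corner.
    set b : Fin d → ℝ := Function.update (Function.update A c α) c' α' with hb
    have hbc : b c = α := by simp [hb, Function.update_of_ne hcc]
    have hbc' : b c' = α' := by simp [hb]
    have hbi : ∀ i, i ≠ c → i ≠ c' → b i = A i := fun i hi hi' => by
      simp [hb, Function.update_of_ne hi, Function.update_of_ne hi']
    have hb1 : ∀ i, A i ≤ b i ∧ b i + r ≤ B i := by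
      intro i
      by_cases hi : i = c
      · subst hi; rw [hbc]; constructor <;> linarith
      by_cases hi' : i = c'
      · subst hi'; rw [hbc']; constructor <;> linarith
      rw [hbi i hi hi']
      have := h1 i
      constructor <;> linarith
    refine hC q hq f hf P hP P' hP' b r hr _ _ (cube_subset_box fun i => ?_)
      (cube_subset_box fun i => ?_) ?_
    · by_cases hi : i = c
      · subst hi; rw [hbc]; simp only [Function.update_self]; exact ⟨le_rfl, f2⟩
      · simp only [Function.update_of_ne hi]; exact hb1 i
    · by_cases hi : i = c'
      · subst hi; rw [hbc']; simp only [Function.update_self]; exact ⟨le_rfl, g2⟩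
      · simp only [Function.update_of_ne hi]; exact hb1 i
    · intro x hx i
      have hx1 := mem_box.1 (hslab _ _ _ hF' hx).1 i
      have := hb1 i
      have := h2 i
      rw [abs_le]
      constructor <;> linarith
  -- The inner side is at most `3 r` and the outer one at least `4 r`, so the two boxes cannot share
  -- both faces orthogonal to an axis.
  have hexists : ∀ c, ∃ α β, Far c α β := by
    intro c
    rcases hA c with hA0 | hA0
    · rcases hB c with hB0 | hB0
      · exfalso; have := h1 c; have := h3 c; rw [hA0, hB0] at this; linarith
      · exact ⟨B' c, B c, by have := h4 c; linarith, hB0, le_rfl, Or.inr le_rfl⟩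
    · refine ⟨A c, A' c, le_rfl, hA0, ?_, Or.inl le_rfl⟩
      have := h4 c
      rcases hB c with hB0 | hB0 <;> linarith
  let c₀ : Fin d := ⟨0, by omega⟩
  let c₁ : Fin d := ⟨1, by omega⟩
  have hc01 : c₀ ≠ c₁ := by simp [c₀, c₁]
  obtain ⟨α₀, β₀, hF₀⟩ := hexists c₀
  obtain ⟨α₁, β₁, hF₁⟩ := hexists c₁
  obtain ⟨P, hP, hPe⟩ := hpoly _ _ _ hF₀
  obtain ⟨P₁, hP₁, hPe₁⟩ := hpoly _ _ _ hF₁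
  have hP1 : LqNorm (fun x => f x - MvPolynomial.eval x P) (slab c₁ α₁ β₁) q ≤
      (C * (Cb + Cb) : NNReal) * e := by
    refine (hglue _ _ _ _ _ _ hc01 hF₀ hF₁ P hP P₁ hP₁).trans ?_
    push_cast
    rw [mul_assoc, add_mul]
    gcongr
  have hall : ∀ c α β, Far c α β →
      LqNorm (fun x => f x - MvPolynomial.eval x P) (slab c α β) q ≤
      (C * (C * (Cb + Cb) + Cb) : NNReal) * e := by
    intro c α β hF
    obtain ⟨P', hP', hPe'⟩ := hpoly _ _ _ hF
    -- A slab parallel to the base slab may be disjoint from it; it is reached through the slab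
    -- orthogonal to `c₁`. This detour is where `d ≥ 2` enters.
    by_cases hc : c₀ = c
    · have hc' : c₁ ≠ c := fun h => hc01 (hc.trans h.symm)
      refine (hglue _ _ _ _ _ _ hc' hF₁ hF P hP P' hP').trans ?_
      push_cast at hP1 ⊢
      rw [mul_assoc, add_mul]
      gcongr
    · refine (hglue _ _ _ _ _ _ hc hF₀ hF P hP P' hP').trans ?_
      have : (Cb : ℝ≥0∞) * e ≤ (C * (Cb + Cb) : NNReal) * e := by
        gcongr
        calc Cb = 1 * Cb := (one_mul _).symm
          _ ≤ C * (Cb + Cb) := mul_le_mul' hC1 le_self_add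
      push_cast at this ⊢
      rw [mul_assoc, add_mul]
      gcongr
      exact hPe.trans this
  refine ⟨P, hP, ?_⟩
  -- A point outside the inner box violates one of its `2d` inequalities; each violation set is
  -- empty or a far slab.
  let T : Fin d × Bool → Set (Fin d → ℝ) := fun s =>
    if s.2 then {x ∈ box A B | B' s.1 ≤ x s.1} else {x ∈ box A B | x s.1 < A' s.1}
  have hT : ∀ s, LqNorm (fun x => f x - MvPolynomial.eval x P) (T s) q ≤
      (C * (C * (Cb + Cb) + Cb) : NNReal) * e := by
    rintro ⟨c, σ⟩
    cases σ
    · rcases hA c with h | h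
      · have : T (c, false) = ∅ := by
          ext x
          simp only [T, Bool.false_eq_true, if_false, Set.mem_ofPred_eq, Set.mem_empty_iff_false,
            iff_false, not_and, not_lt, mem_box]
          intro hx
          linarith [hx c]
        rw [this, LqNorm_empty]
        exact zero_le
      · have hF : Far c (A c) (A' c) := by
          refine ⟨le_rfl, h, ?_, Or.inl le_rfl⟩
          have := h4 c
          rcases hB c with hB0 | hB0 <;> linarith
        refine (LqNorm_mono q ?_).trans (hall _ _ _ hF)
        intro x hx
        simp only [T, Bool.false_eq_true, if_false, Set.mem_ofPred_eq, mem_box] at hx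
        refine mem_box.2 fun i => ?_
        by_cases hi : i = c
        · subst hi; simp only [Function.update_self]; exact ⟨(hx.1 i).1, hx.2⟩
        · simp only [Function.update_of_ne hi]; exact hx.1 i
    · rcases hB c with h | h
      · have : T (c, true) = ∅ := by
          ext x
          simp only [T, if_true, Set.mem_ofPred_eq, Set.mem_empty_iff_false,
            iff_false, not_and, not_le, mem_box]
          intro hx
          linarith [hx c]
        rw [this, LqNorm_empty]
        exact zero_le
      · have hF : Far c (B' c) (B c) := by
          refine ⟨?_, h, le_rfl, Or.inr le_rfl⟩
          have := h4 c
          rcases hA c with hA0 | hA0 <;> linarith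
        refine (LqNorm_mono q ?_).trans (hall _ _ _ hF)
        intro x hx
        simp only [T, if_true, Set.mem_ofPred_eq, mem_box] at hx
        refine mem_box.2 fun i => ?_
        by_cases hi : i = c
        · subst hi; simp only [Function.update_self]; exact ⟨hx.2, (hx.1 i).2⟩
        · simp only [Function.update_of_ne hi]; exact hx.1 i
  have hcov : box A B \ box A' B' ⊆ ⋃ s ∈ (Finset.univ : Finset (Fin d × Bool)), T s := by
    rintro x ⟨hx, hx'⟩
    rw [mem_box] at hx'
    push Not at hx'
    obtain ⟨c, hc⟩ := hx'
    simp only [Finset.mem_univ, Set.iUnion_true, Set.mem_iUnion]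
    by_cases h : A' c ≤ x c
    · exact ⟨(c, true), by simpa [T] using ⟨hx, hc h⟩⟩
    · exact ⟨(c, false), by simpa [T] using ⟨hx, not_le.1 h⟩⟩
  refine (LqNorm_mono q hcov).trans ((LqNorm_biUnion_le hq _ _ _).trans ?_)
  refine (Finset.sum_le_card_nsmul _ _ _ fun s _ => hT s).trans ?_
  simp only [Finset.card_univ, Fintype.card_prod, Fintype.card_fin, Fintype.card_bool,
    nsmul_eq_mul]
  calc _ = (2 * d * (C * (C * (Cb + Cb) + Cb)) : NNReal) * e := by push_cast; ring
    _ ≤ _ := by gcongr; exact le_self_add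

/-! ### Dyadic grids -/

/-- The dyadic cube `2^{-j}([0,1)^d + α)`. -/
def dyadic (j : ℕ) (α : Fin d → ℤ) : Set (Fin d → ℝ) :=
  cube (fun i => (α i : ℝ) / 2 ^ j) (1 / 2 ^ j)

theorem mem_dyadic {j : ℕ} {α : Fin d → ℤ} {x : Fin d → ℝ} :
    x ∈ dyadic j α ↔ (fun i => ⌊x i * 2 ^ j⌋) = α := by
  have h2 : (0 : ℝ) < 2 ^ j := by positivity
  rw [dyadic, mem_cube, funext_iff]
  refine forall_congr' fun i => ?_
  rw [Int.floor_eq_iff, ← add_div, div_le_iff₀ h2, lt_div_iff₀ h2]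

theorem measurableSet_dyadic (j : ℕ) (α : Fin d → ℤ) : MeasurableSet (dyadic j α) :=
  measurableSet_cube _ _

theorem disjoint_dyadic {j : ℕ} {α α' : Fin d → ℤ} (h : α ≠ α') :
    Disjoint (dyadic j α) (dyadic j α') :=
  Set.disjoint_left.2 fun _ hx hy => h ((mem_dyadic.1 hx).symm.trans (mem_dyadic.1 hy))

/-- A union of dyadic cubes of the same level. -/
def gridSet (j : ℕ) (F : Finset (Fin d → ℤ)) : Set (Fin d → ℝ) := ⋃ α ∈ F, dyadic j α

theorem mem_gridSet {j : ℕ} {F : Finset (Fin d → ℤ)} {x : Fin d → ℝ} :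
    x ∈ gridSet j F ↔ (fun i => ⌊x i * 2 ^ j⌋) ∈ F := by
  simp [gridSet, mem_dyadic]

theorem measurableSet_gridSet (j : ℕ) (F : Finset (Fin d → ℤ)) : MeasurableSet (gridSet j F) :=
  F.measurableSet_biUnion fun _ _ => measurableSet_dyadic _ _

theorem dyadic_subset_gridSet {j : ℕ} {F : Finset (Fin d → ℤ)} {α : Fin d → ℤ} (h : α ∈ F) :
    dyadic j α ⊆ gridSet j F := fun x hx => by
  rw [mem_gridSet, mem_dyadic.1 hx]; exact h

theorem gridSet_sdiff (j : ℕ) (F G : Finset (Fin d → ℤ)) :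
    gridSet j (F \ G) = gridSet j F \ gridSet j G := by
  ext x; simp [mem_gridSet]

theorem gridSet_singleton (j : ℕ) (α : Fin d → ℤ) : gridSet j {α} = dyadic j α := by
  simp [gridSet]

/-- A box whose vertices lie on the dyadic grid of level `J - t` is a union of dyadic cubes of
that level. -/
theorem box_eq_gridSet {J t : ℕ} (ht : t ≤ J) {a b : Fin d → ℤ} (ha : ∀ i, (2 : ℤ) ^ t ∣ a i)
    (hb : ∀ i, (2 : ℤ) ^ t ∣ b i) :
    box (fun i => (a i : ℝ) / 2 ^ J) (fun i => (b i : ℝ) / 2 ^ J) =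
      gridSet (J - t) (Fintype.piFinset fun i => Finset.Ico (a i / 2 ^ t) (b i / 2 ^ t)) := by
  ext x
  rw [mem_box, mem_gridSet, Fintype.mem_piFinset]
  refine forall_congr' fun i => ?_
  obtain ⟨a', ha'⟩ := ha i
  obtain ⟨b', hb'⟩ := hb i
  have hp : (2 : ℤ) ^ t ≠ 0 := by positivity
  have hJ : (2 : ℝ) ^ J = 2 ^ t * 2 ^ (J - t) := by rw [← pow_add, Nat.add_sub_cancel' ht]
  have h0 : (0 : ℝ) < 2 ^ t := by positivity
  have h1 : (0 : ℝ) < 2 ^ (J - t) := by positivity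
  rw [ha', hb', Int.mul_ediv_cancel_left _ hp, Int.mul_ediv_cancel_left _ hp, Finset.mem_Ico,
    Int.le_floor, Int.floor_lt, hJ]
  push_cast
  rw [mul_div_mul_left _ _ h0.ne', mul_div_mul_left _ _ h0.ne', div_le_iff₀ h1, lt_div_iff₀ h1]

theorem card_piFinset_Ico_le {t c : ℕ} {a b : Fin d → ℤ} (ha : ∀ i, (2 : ℤ) ^ t ∣ a i)
    (hb : ∀ i, (2 : ℤ) ^ t ∣ b i) (h : ∀ i, b i ≤ a i + c * 2 ^ t) :
    (Fintype.piFinset fun i => Finset.Ico (a i / 2 ^ t) (b i / 2 ^ t)).card ≤ c ^ d := by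
  rw [Fintype.card_piFinset]
  refine (Finset.prod_le_pow_card _ _ c fun i _ => ?_).trans (by simp)
  obtain ⟨a', ha'⟩ := ha i
  obtain ⟨b', hb'⟩ := hb i
  have hp : (2 : ℤ) ^ t ≠ 0 := by positivity
  have hp0 : (0 : ℤ) < 2 ^ t := by positivity
  rw [ha', hb', Int.mul_ediv_cancel_left _ hp, Int.mul_ediv_cancel_left _ hp, Int.card_Ico,
    Int.toNat_le]
  have := h i
  rw [ha', hb'] at this
  have h2 : (2 : ℤ) ^ t * b' ≤ 2 ^ t * (a' + c) := by linarith
  have := le_of_mul_le_mul_left h2 hp0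
  linarith

/-! ### Sums of polynomials on dyadic cubes -/

/-- `g` is a sum of at most `n` polynomials of degree at most `l` restricted to dyadic cubes. -/
def IsDyadicSum (l n : ℕ) (g : (Fin d → ℝ) → ℝ) : Prop :=
  ∃ Δ : Finset (Set (Fin d → ℝ)), (∀ K ∈ Δ, K ∈ dyadicCubes d) ∧ Δ.card ≤ n ∧
    g ∈ piecewisePolys l Δ

theorem add_mem_piecewisePolys [DecidableEq (Set (Fin d → ℝ))] {l : ℕ}
    {Δ₁ Δ₂ : Finset (Set (Fin d → ℝ))} {g₁ g₂ : (Fin d → ℝ) → ℝ}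
    (h₁ : g₁ ∈ piecewisePolys l Δ₁) (h₂ : g₂ ∈ piecewisePolys l Δ₂) :
    (fun x => g₁ x + g₂ x) ∈ piecewisePolys l (Δ₁ ∪ Δ₂) := by
  obtain ⟨P₁, hP₁, rfl⟩ := h₁
  obtain ⟨P₂, hP₂, rfl⟩ := h₂
  -- A cube common to both families receives the sum of its two polynomials.
  refine ⟨fun K => (if K ∈ Δ₁ then P₁ K else 0) + (if K ∈ Δ₂ then P₂ K else 0),
    fun K _ => Submodule.add_mem _ ?_ ?_, ?_⟩
  · split_ifs with h
    exacts [hP₁ K h, Submodule.zero_mem _]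
  · split_ifs with h
    exacts [hP₂ K h, Submodule.zero_mem _]
  · ext x
    have key : ∀ (Δ Δ' : Finset (Set (Fin d → ℝ))) (P : Set (Fin d → ℝ) → MvPolynomial (Fin d) ℝ),
        Δ ⊆ Δ' → ∑ K ∈ Δ, K.indicator (fun y => MvPolynomial.eval y (P K)) x =
          ∑ K ∈ Δ', K.indicator
            (fun y => MvPolynomial.eval y (if K ∈ Δ then P K else 0)) x := by
      intro Δ Δ' P hsub
      rw [← Finset.sum_subset hsub]
      · refine Finset.sum_congr rfl fun K hK => ?_
        rw [if_pos hK]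
      · intro K _ hK
        rw [if_neg hK]
        simp
    beta_reduce
    rw [key Δ₁ _ P₁ Finset.subset_union_left, key Δ₂ _ P₂ Finset.subset_union_right,
      ← Finset.sum_add_distrib]
    refine Finset.sum_congr rfl fun K _ => ?_
    by_cases hx : x ∈ K <;> simp [hx]

theorem IsDyadicSum.add {l n₁ n₂ : ℕ} {g₁ g₂ : (Fin d → ℝ) → ℝ} (h₁ : IsDyadicSum l n₁ g₁)
    (h₂ : IsDyadicSum l n₂ g₂) : IsDyadicSum l (n₁ + n₂) fun x => g₁ x + g₂ x := by
  classical
  obtain ⟨Δ₁, hΔ₁, hc₁, hg₁⟩ := h₁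
  obtain ⟨Δ₂, hΔ₂, hc₂, hg₂⟩ := h₂
  refine ⟨Δ₁ ∪ Δ₂, fun K hK => ?_, (Finset.card_union_le _ _).trans (add_le_add hc₁ hc₂),
    add_mem_piecewisePolys hg₁ hg₂⟩
  rcases Finset.mem_union.1 hK with h | h
  exacts [hΔ₁ K h, hΔ₂ K h]

theorem IsDyadicSum.mono {l n n' : ℕ} {g : (Fin d → ℝ) → ℝ} (h : IsDyadicSum l n g)
    (hn : n ≤ n') : IsDyadicSum l n' g := by
  obtain ⟨Δ, h1, h2, h3⟩ := h
  exact ⟨Δ, h1, h2.trans hn, h3⟩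

theorem isDyadicSum_zero (l : ℕ) : IsDyadicSum l 0 (fun _ : Fin d → ℝ => (0 : ℝ)) :=
  ⟨∅, by simp, by simp, fun _ => 0, by simp, by simp⟩

theorem isDyadicSum_dyadic {l j : ℕ} {α : Fin d → ℤ} (hα : dyadic j α ⊆ unitCube d)
    {P : MvPolynomial (Fin d) ℝ} (hP : P ∈ polys d l) :
    IsDyadicSum l 1 ((dyadic j α).indicator fun y => MvPolynomial.eval y P) := by
  refine ⟨{dyadic j α}, ?_, by simp, fun _ => P, fun _ _ => hP, by ext x; simp⟩
  intro K hK
  rw [Finset.mem_singleton] at hK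
  subst hK
  exact ⟨hα, j, α, rfl⟩

theorem isDyadicSum_gridSet {l j : ℕ} {F : Finset (Fin d → ℤ)} (hF : gridSet j F ⊆ unitCube d)
    {P : MvPolynomial (Fin d) ℝ} (hP : P ∈ polys d l) :
    IsDyadicSum l F.card ((gridSet j F).indicator fun y => MvPolynomial.eval y P) := by
  classical
  induction F using Finset.induction_on with
  | empty => simpa [gridSet] using isDyadicSum_zero l
  | insert α F hα ih =>
    have hu : gridSet j (insert α F) = dyadic j α ∪ gridSet j F := by simp [gridSet]
    rw [hu, Set.union_subset_iff] at hF
    have hdisj : Disjoint (dyadic j α) (gridSet j F) := by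
      refine Set.disjoint_left.2 fun x hx hx' => hα ?_
      rw [mem_gridSet, mem_dyadic.1 hx] at hx'
      exact hx'
    rw [hu, Set.indicator_union_of_disjoint hdisj, Finset.card_insert_of_notMem hα, add_comm]
    exact (isDyadicSum_dyadic hF.1 hP).add (ih hF.2)

/-- `f` is approximable on `R` by a sum of `n` polynomials restricted to dyadic cubes, with an
error of `ε` per summand. -/
def Approximable (l : ℕ) (q : ℝ) (f : (Fin d → ℝ) → ℝ) (ε : ℝ≥0∞) (R : Set (Fin d → ℝ))
    (n : ℕ) : Prop :=
  ∃ g : (Fin d → ℝ) → ℝ, IsDyadicSum l n g ∧ (∀ x ∉ R, g x = 0) ∧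
    ∫⁻ x in R, ‖f x - g x‖ₑ ^ q ≤ n * ε ^ q

section Approximable

variable {l : ℕ} {q : ℝ} {f : (Fin d → ℝ) → ℝ} {ε : ℝ≥0∞} {R R₁ R₂ : Set (Fin d → ℝ)}
  {n n' n₁ n₂ : ℕ}

theorem Approximable.mono (h : Approximable l q f ε R n) (hn : n ≤ n') :
    Approximable l q f ε R n' := by
  obtain ⟨g, h1, h2, h3⟩ := h
  exact ⟨g, h1.mono hn, h2, h3.trans (by gcongr)⟩

theorem approximable_empty : Approximable l q f ε ∅ 0 :=
  ⟨fun _ => 0, isDyadicSum_zero l, fun _ _ => rfl, by simp⟩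

/-- Each approximant vanishes off its own region, so the two do not interfere and the `q`-th powers
of the errors add. -/
theorem Approximable.union (h₁ : Approximable l q f ε R₁ n₁) (h₂ : Approximable l q f ε R₂ n₂)
    (hd : Disjoint R₁ R₂) (m₁ : MeasurableSet R₁) (m₂ : MeasurableSet R₂) :
    Approximable l q f ε (R₁ ∪ R₂) (n₁ + n₂) := by
  obtain ⟨g₁, a1, b1, c1⟩ := h₁
  obtain ⟨g₂, a2, b2, c2⟩ := h₂
  refine ⟨_, a1.add a2, fun x hx => ?_, ?_⟩
  · rw [Set.mem_union, not_or] at hx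
    rw [b1 x hx.1, b2 x hx.2, add_zero]
  · refine (lintegral_union_le _ _ _).trans ?_
    push_cast
    rw [add_mul]
    refine add_le_add (le_trans (le_of_eq ?_) c1) (le_trans (le_of_eq ?_) c2)
    · refine setLIntegral_congr_fun m₁ fun x hx => ?_
      rw [b2 x (Set.disjoint_left.1 hd hx), add_zero]
    · refine setLIntegral_congr_fun m₂ fun x hx => ?_
      rw [b1 x (Set.disjoint_right.1 hd hx), zero_add]

theorem Approximable.biUnion {ι : Type*} (s : Finset ι) {T : ι → Set (Fin d → ℝ)} {c : ι → ℕ}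
    (h : ∀ i ∈ s, Approximable l q f ε (T i) (c i)) (hd : ∀ i j, i ≠ j → Disjoint (T i) (T j))
    (hm : ∀ i, MeasurableSet (T i)) :
    Approximable l q f ε (⋃ i ∈ s, T i) (∑ i ∈ s, c i) := by
  classical
  induction s using Finset.induction_on with
  | empty => simpa using approximable_empty
  | insert a s ha ih =>
    rw [Finset.set_biUnion_insert, Finset.sum_insert ha]
    refine (h a (Finset.mem_insert_self _ _)).union
      (ih fun i hi => h i (Finset.mem_insert_of_mem hi)) ?_ (hm a)
      (s.measurableSet_biUnion fun i _ => hm i)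
    rw [Set.disjoint_iUnion₂_right]
    intro i hi
    exact hd a i fun h => ha (h ▸ hi)

theorem approximable_of_poly (hq : 1 ≤ q) {P : MvPolynomial (Fin d) ℝ}
    (hR : MeasurableSet R) (hP : LqNorm (fun x => f x - MvPolynomial.eval x P) R q ≤ ε)
    (hn : 1 ≤ n) (hsum : IsDyadicSum l n (R.indicator fun y => MvPolynomial.eval y P)) :
    Approximable l q f ε R n := by
  refine ⟨_, hsum, fun x hx => Set.indicator_of_notMem hx _, ?_⟩
  calc _ = ∫⁻ x in R, ‖f x - MvPolynomial.eval x P‖ₑ ^ q :=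
        setLIntegral_congr_fun hR fun x hx => by simp only [Set.indicator_of_mem hx]
    _ = LqNorm (fun x => f x - MvPolynomial.eval x P) R q ^ q := (LqNorm_rpow hq _ _).symm
    _ ≤ 1 * ε ^ q := by
      rw [one_mul]
      exact ENNReal.rpow_le_rpow hP (by linarith)
    _ ≤ _ := by
      gcongr
      exact_mod_cast hn

theorem approximable_dyadic (hq : 1 ≤ q) {j : ℕ} {α : Fin d → ℤ}
    (hα : dyadic j α ⊆ unitCube d) {P : MvPolynomial (Fin d) ℝ} (hP : P ∈ polys d l)
    (hε : LqNorm (fun x => f x - MvPolynomial.eval x P) (dyadic j α) q ≤ ε) :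
    Approximable l q f ε (dyadic j α) 1 :=
  approximable_of_poly hq (measurableSet_dyadic j α) hε le_rfl (isDyadicSum_dyadic hα hP)

theorem LocallyApproximable.approximable_gridSet (hq : 1 ≤ q) {e : ℝ≥0∞} {S : Set (Fin d → ℝ)}
    (h : LocallyApproximable l q f e S) (he : e ≤ ε) {j : ℕ} {F : Finset (Fin d → ℤ)}
    (hF : gridSet j F ⊆ S) (hS : S ⊆ unitCube d) :
    Approximable l q f ε (gridSet j F) F.card := by
  rw [Finset.card_eq_sum_ones]
  refine Approximable.biUnion F (c := fun _ => 1) (fun α hα => ?_)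
    (fun _ _ => disjoint_dyadic) (measurableSet_dyadic j)
  have hsub := (dyadic_subset_gridSet hα).trans hF
  obtain ⟨P, hP, hPe⟩ := h _ _ (by positivity) hsub
  exact approximable_dyadic hq (hsub.trans hS) hP (hPe.trans he)

/-- The difference may require many dyadic cubes to tile when `j'` is much larger than `j`. Placing
`P` on the cubes of `F` and `-P` on those of `F'` costs only `F.card + F'.card` terms. -/
theorem approximable_gridSet_diff (hq : 1 ≤ q) {j j' : ℕ} {F F' : Finset (Fin d → ℤ)}
    (hF : gridSet j F ⊆ unitCube d) (hFF : gridSet j' F' ⊆ gridSet j F) (hcard : 1 ≤ n)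
    (hn : F.card + F'.card ≤ n) {P : MvPolynomial (Fin d) ℝ} (hP : P ∈ polys d l)
    (hε : LqNorm (fun x => f x - MvPolynomial.eval x P) (gridSet j F \ gridSet j' F') q ≤ ε) :
    Approximable l q f ε (gridSet j F \ gridSet j' F') n := by
  refine approximable_of_poly hq
    ((measurableSet_gridSet _ _).diff (measurableSet_gridSet _ _)) hε hcard ?_
  have h1 := isDyadicSum_gridSet hF hP
  have h2 := isDyadicSum_gridSet (hFF.trans hF) (Submodule.neg_mem _ hP)
  convert! (h1.add h2).mono hn using 1
  ext x
  by_cases hx' : x ∈ gridSet j' F'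
  · simp [hx', hFF hx']
  · by_cases hx : x ∈ gridSet j F <;> simp [hx, hx']

end Approximable

/-! ### Clipped triples of dyadic ancestors and the rings between them -/

/-- The largest multiple of `2 ^ t` not exceeding `β`. -/
def dyadicFloor (β : ℤ) (t : ℕ) : ℤ := 2 ^ t * (β / 2 ^ t)

theorem dvd_dyadicFloor (β : ℤ) (t : ℕ) : (2 : ℤ) ^ t ∣ dyadicFloor β t := Dvd.intro _ rfl

theorem dyadicFloor_le (β : ℤ) (t : ℕ) : dyadicFloor β t ≤ β :=
  Int.mul_ediv_self_le (by positivity)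

theorem lt_dyadicFloor_add (β : ℤ) (t : ℕ) : β < dyadicFloor β t + 2 ^ t :=
  Int.lt_mul_ediv_self_add (by positivity)

theorem dyadicFloor_anti (β : ℤ) {t t' : ℕ} (h : t ≤ t') :
    dyadicFloor β t' ≤ dyadicFloor β t := by
  have hp : (0 : ℤ) < 2 ^ t := by positivity
  obtain ⟨c, hc⟩ := (pow_dvd_pow (2 : ℤ) h).trans (dvd_dyadicFloor β t')
  have h1 := dyadicFloor_le β t'
  rw [hc] at h1 ⊢
  exact mul_le_mul_of_nonneg_left ((Int.le_ediv_iff_mul_le hp).2 (by linarith)) hp.le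

theorem dyadicFloor_add_mono (β : ℤ) {t t' : ℕ} (h : t ≤ t') :
    dyadicFloor β t + 2 ^ t ≤ dyadicFloor β t' + 2 ^ t' := by
  have hp : (0 : ℤ) < 2 ^ t := by positivity
  obtain ⟨c, hc⟩ := (pow_dvd_pow (2 : ℤ) h).trans
    ((dvd_dyadicFloor β t').add (dvd_refl ((2 : ℤ) ^ t')))
  have h1 := lt_dyadicFloor_add β t'
  rw [hc] at h1 ⊢
  have h2 : β / 2 ^ t < c := (Int.ediv_lt_iff_lt_mul hp).2 (by linarith)
  unfold dyadicFloor
  nlinarith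

/-- The left end of the intersection of the tripled dyadic interval of length `2 ^ t` containing
`β` with the dyadic interval of length `2 ^ m` containing `β`. -/
def lowEnd (m t : ℕ) (β : ℤ) : ℤ := max (dyadicFloor β t - 2 ^ t) (dyadicFloor β m)

/-- The right end of the intersection of the tripled dyadic interval of length `2 ^ t` containing
`β` with the dyadic interval of length `2 ^ m` containing `β`. -/
def highEnd (m t : ℕ) (β : ℤ) : ℤ := min (dyadicFloor β t + 2 * 2 ^ t) (dyadicFloor β m + 2 ^ m)

section Ends

variable {m t t' : ℕ} (β : ℤ)

theorem dvd_lowEnd (h : t ≤ m) : (2 : ℤ) ^ t ∣ lowEnd m t β := by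
  unfold lowEnd
  rcases max_choice (dyadicFloor β t - 2 ^ t) (dyadicFloor β m) with h' | h' <;> rw [h']
  · exact (dvd_dyadicFloor β t).sub (dvd_refl _)
  · exact (pow_dvd_pow 2 h).trans (dvd_dyadicFloor β m)

theorem dvd_highEnd (h : t ≤ m) : (2 : ℤ) ^ t ∣ highEnd m t β := by
  unfold highEnd
  rcases min_choice (dyadicFloor β t + 2 * 2 ^ t) (dyadicFloor β m + 2 ^ m) with h' | h' <;>
    rw [h']
  · exact (dvd_dyadicFloor β t).add (Dvd.intro_left _ rfl)
  · exact (pow_dvd_pow 2 h).trans ((dvd_dyadicFloor β m).add (dvd_refl _))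

theorem lowEnd_le_dyadicFloor (h : t ≤ m) : lowEnd m t β ≤ dyadicFloor β t :=
  max_le (by have : (0 : ℤ) < 2 ^ t := by positivity
             linarith) (dyadicFloor_anti β h)

theorem dyadicFloor_add_le_highEnd (h : t ≤ m) : dyadicFloor β t + 2 ^ t ≤ highEnd m t β :=
  le_min (by have : (0 : ℤ) < 2 ^ t := by positivity
             linarith) (dyadicFloor_add_mono β h)

theorem lowEnd_self : lowEnd m m β = dyadicFloor β m :=
  max_eq_right (by have : (0 : ℤ) < 2 ^ m := by positivity
                   linarith)

theorem highEnd_self : highEnd m m β = dyadicFloor β m + 2 ^ m :=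
  min_eq_right (by have : (0 : ℤ) < 2 ^ m := by positivity
                   linarith)

theorem highEnd_le_lowEnd_add : highEnd m t β ≤ lowEnd m t β + 3 * 2 ^ t := by
  have h1 : highEnd m t β ≤ dyadicFloor β t + 2 * 2 ^ t := min_le_left _ _
  have h2 : dyadicFloor β t - 2 ^ t ≤ lowEnd m t β := le_max_left _ _
  linarith

theorem lowEnd_anti (h : t ≤ t') : lowEnd m t' β ≤ lowEnd m t β := by
  have h1 := dyadicFloor_anti β h
  have h2 : (2 : ℤ) ^ t ≤ 2 ^ t' := pow_le_pow_right₀ (by norm_num) h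
  exact max_le_max (by linarith) le_rfl

theorem highEnd_mono (h : t ≤ t') : highEnd m t β ≤ highEnd m t' β := by
  have h1 := dyadicFloor_add_mono β h
  have h2 : (2 : ℤ) ^ t ≤ 2 ^ t' := pow_le_pow_right₀ (by norm_num) h
  exact min_le_min (by linarith) le_rfl

/-- An untouched face means that the larger triple is not clipped on this side; the margin of the
triple then shrinks from `2 ^ t'` to `2 ^ t`. This yields the gap required in
`exists_poly_box_diff`. -/
theorem lowEnd_far (h : t ≤ t') (hfar : lowEnd m t' β ≠ dyadicFloor β m) :
    lowEnd m t' β + (2 ^ t' - 2 ^ t) ≤ lowEnd m t β := by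
  have h1 : lowEnd m t' β = dyadicFloor β t' - 2 ^ t' := by
    rcases max_choice (dyadicFloor β t' - 2 ^ t') (dyadicFloor β m) with h' | h'
    · exact h'
    · exact absurd h' hfar
  have h2 : dyadicFloor β t - 2 ^ t ≤ lowEnd m t β := le_max_left _ _
  have h3 := dyadicFloor_anti β h
  linarith

theorem highEnd_far (h : t ≤ t') (hfar : highEnd m t' β ≠ dyadicFloor β m + 2 ^ m) :
    highEnd m t β + (2 ^ t' - 2 ^ t) ≤ highEnd m t' β := by
  have h1 : highEnd m t' β = dyadicFloor β t' + 2 * 2 ^ t' := by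
    rcases min_choice (dyadicFloor β t' + 2 * 2 ^ t') (dyadicFloor β m + 2 ^ m) with h' | h'
    · exact h'
    · exact absurd h' hfar
  have h2 : highEnd m t β ≤ dyadicFloor β t + 2 * 2 ^ t := min_le_left _ _
  have h3 := dyadicFloor_add_mono β h
  linarith

theorem dyadicFloor_le_lowEnd : dyadicFloor β m ≤ lowEnd m t β := le_max_right _ _

theorem highEnd_le_dyadicFloor_add : highEnd m t β ≤ dyadicFloor β m + 2 ^ m := min_le_right _ _

end Ends

/-- The intersection of the tripled dyadic cube of level `J - t` containing `dyadic J β` with the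
dyadic cube of level `J - m` containing it. -/
def neighborhood (J m t : ℕ) (β : Fin d → ℤ) : Set (Fin d → ℝ) :=
  box (fun i => (lowEnd m t (β i) : ℝ) / 2 ^ J) (fun i => (highEnd m t (β i) : ℝ) / 2 ^ J)

theorem box_int_subset {J : ℕ} {a b a' b' : Fin d → ℤ} (ha : ∀ i, a i ≤ a' i)
    (hb : ∀ i, b' i ≤ b i) :
    box (fun i => (a' i : ℝ) / 2 ^ J) (fun i => (b' i : ℝ) / 2 ^ J) ⊆
      box (fun i => (a i : ℝ) / 2 ^ J) (fun i => (b i : ℝ) / 2 ^ J) := by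
  intro x hx
  rw [mem_box] at hx ⊢
  intro i
  have h1 : (a i : ℝ) / 2 ^ J ≤ (a' i : ℝ) / 2 ^ J := by gcongr; exact_mod_cast ha i
  have h2 : (b' i : ℝ) / 2 ^ J ≤ (b i : ℝ) / 2 ^ J := by gcongr; exact_mod_cast hb i
  exact ⟨h1.trans (hx i).1, (hx i).2.trans_le h2⟩

theorem dyadic_eq_box {J t : ℕ} (ht : t ≤ J) (β : Fin d → ℤ) :
    dyadic (J - t) (fun i => β i / 2 ^ t) =
      box (fun i => (dyadicFloor (β i) t : ℝ) / 2 ^ J)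
        (fun i => ((dyadicFloor (β i) t + 2 ^ t : ℤ) : ℝ) / 2 ^ J) := by
  rw [box_eq_gridSet ht (fun i => dvd_dyadicFloor _ _)
    (fun i => (dvd_dyadicFloor _ _).add (dvd_refl _)), ← gridSet_singleton]
  congr 1
  ext α
  have hp : (2 : ℤ) ^ t ≠ 0 := by positivity
  simp only [Finset.mem_singleton, Fintype.mem_piFinset, Finset.mem_Ico, funext_iff]
  refine forall_congr' fun i => ?_
  have h1 : dyadicFloor (β i) t / 2 ^ t = β i / 2 ^ t := Int.mul_ediv_cancel_left _ hp
  have h2 : (dyadicFloor (β i) t + 2 ^ t) / 2 ^ t = β i / 2 ^ t + 1 := by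
    rw [Int.add_ediv_of_dvd_right (dvd_refl _), h1, Int.ediv_self hp]
  rw [h1, h2]
  omega

theorem neighborhood_self {J m : ℕ} (hm : m ≤ J) (β : Fin d → ℤ) :
    neighborhood J m m β = dyadic (J - m) (fun i => β i / 2 ^ m) := by
  rw [dyadic_eq_box hm, neighborhood]
  simp only [lowEnd_self, highEnd_self]

theorem neighborhood_mono {J m t t' : ℕ} (h : t ≤ t') (β : Fin d → ℤ) :
    neighborhood J m t β ⊆ neighborhood J m t' β :=
  box_int_subset (fun i => lowEnd_anti (β i) h) (fun i => highEnd_mono (β i) h)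

theorem dyadic_subset_neighborhood {J m : ℕ} (t : ℕ) (β : Fin d → ℤ) :
    dyadic J β ⊆ neighborhood J m t β := by
  have h0 := dyadic_eq_box (Nat.zero_le J) β
  simp only [pow_zero, Int.ediv_one, Nat.sub_zero] at h0
  rw [h0]
  have hz : ∀ b : ℤ, dyadicFloor b 0 = b := fun b => by simp [dyadicFloor]
  refine box_int_subset (fun i => ?_) (fun i => ?_)
  · rw [hz]
    exact max_le (by have := dyadicFloor_le (β i) t
                     have : (0 : ℤ) < 2 ^ t := by positivity
                     linarith) (dyadicFloor_le _ _)
  · rw [hz]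
    refine le_min ?_ ?_
    · have := lt_dyadicFloor_add (β i) t
      have : (0 : ℤ) < 2 ^ t := by positivity
      linarith
    · have := lt_dyadicFloor_add (β i) m
      linarith

theorem measurableSet_neighborhood (J m t : ℕ) (β : Fin d → ℤ) :
    MeasurableSet (neighborhood J m t β) := measurableSet_box _ _

/-- The faces of the dyadic cube of level `J - m` that `neighborhood J m t β` touches. -/
def touchedFaces (m t : ℕ) (β : Fin d → ℤ) : Finset (Fin d × Bool) :=
  {s | if s.2 then highEnd m t (β s.1) = dyadicFloor (β s.1) m + 2 ^ m
    else lowEnd m t (β s.1) = dyadicFloor (β s.1) m}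

theorem mem_touchedFaces_false {m t : ℕ} {β : Fin d → ℤ} {i : Fin d} :
    (i, false) ∈ touchedFaces m t β ↔ lowEnd m t (β i) = dyadicFloor (β i) m := by
  simp [touchedFaces]

theorem mem_touchedFaces_true {m t : ℕ} {β : Fin d → ℤ} {i : Fin d} :
    (i, true) ∈ touchedFaces m t β ↔ highEnd m t (β i) = dyadicFloor (β i) m + 2 ^ m := by
  simp [touchedFaces]

theorem touchedFaces_mono {m t t' : ℕ} (h : t ≤ t') (β : Fin d → ℤ) :
    touchedFaces m t β ⊆ touchedFaces m t' β := by
  rintro ⟨i, σ⟩ hs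
  cases σ
  · rw [mem_touchedFaces_false] at hs ⊢
    exact le_antisymm ((lowEnd_anti _ h).trans hs.le) (dyadicFloor_le_lowEnd _)
  · rw [mem_touchedFaces_true] at hs ⊢
    exact le_antisymm (highEnd_le_dyadicFloor_add _) (hs.ge.trans (highEnd_mono _ h))

theorem neighborhood_eq_gridSet {J m t t' : ℕ} (ht : t ≤ t') (htm : t' ≤ m) (hm : m ≤ J)
    (β : Fin d → ℤ) : neighborhood J m t' β = gridSet (J - t) (Fintype.piFinset fun i =>
      Finset.Ico (lowEnd m t' (β i) / 2 ^ t) (highEnd m t' (β i) / 2 ^ t)) :=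
  box_eq_gridSet (by omega) (fun i => (pow_dvd_pow 2 ht).trans (dvd_lowEnd _ htm))
    (fun i => (pow_dvd_pow 2 ht).trans (dvd_highEnd _ htm))

theorem card_neighborhood_le {m t t' c : ℕ} (ht : t ≤ t') (htm : t' ≤ m)
    (hc : 3 * 2 ^ t' ≤ c * 2 ^ t) (β : Fin d → ℤ) :
    (Fintype.piFinset fun i =>
      Finset.Ico (lowEnd m t' (β i) / 2 ^ t) (highEnd m t' (β i) / 2 ^ t)).card ≤ c ^ d := by
  refine card_piFinset_Ico_le (fun i => (pow_dvd_pow 2 ht).trans (dvd_lowEnd _ htm))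
    (fun i => (pow_dvd_pow 2 ht).trans (dvd_highEnd _ htm)) fun i => ?_
  have := highEnd_le_lowEnd_add (m := m) (t := t') (β i)
  have h2 : (3 * 2 ^ t' : ℤ) ≤ c * 2 ^ t := by exact_mod_cast hc
  linarith

/-- If `f` is locally approximable on the difference `Q \ Q'` of two dyadic cubes, then it is
approximable there by a bounded number of pieces. -/
theorem exists_approximable_dyadic_diff (d l : ℕ) (hd : 2 ≤ d) :
    ∃ (C : NNReal) (M : ℕ), 1 ≤ C ∧ 1 ≤ M ∧ ∀ q : ℝ, 1 ≤ q →
      ∀ f : (Fin d → ℝ) → ℝ, Continuous f → ∀ (e : ℝ≥0∞) (J m : ℕ) (β : Fin d → ℤ), m ≤ J →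
      dyadic (J - m) (fun i => β i / 2 ^ m) ⊆ unitCube d →
      LocallyApproximable l q f e (dyadic (J - m) (fun i => β i / 2 ^ m) \ dyadic J β) →
      Approximable l q f (C * e) (dyadic (J - m) (fun i => β i / 2 ^ m) \ dyadic J β) M := by
  obtain ⟨C, hC1, hC⟩ := exists_poly_box_diff d l hd
  set M₀ : ℕ := 2 * 6 ^ d with hM₀
  -- At most `2d` changes of touched faces, each costing one long ring (`M₀`) and one single step
  -- (`6 ^ d`); then a last long ring, and `3 ^ d` cells around `dyadic J β`.
  refine ⟨C, 2 * d * (M₀ + 6 ^ d) + M₀ + 3 ^ d, hC1, ?_, ?_⟩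
  · have : 1 ≤ 3 ^ d := Nat.one_le_pow _ _ (by norm_num)
    omega
  intro q hq f hf e J m β hm hQ hloc
  set D : ℕ → Set (Fin d → ℝ) := fun t => neighborhood J m t β with hD
  have hmono : ∀ {t t'}, t ≤ t' → D t ⊆ D t' := fun h => neighborhood_mono h β
  have hmeas : ∀ t, MeasurableSet (D t) := fun t => measurableSet_neighborhood J m t β
  have hDm : D m = dyadic (J - m) (fun i => β i / 2 ^ m) := neighborhood_self hm β
  rw [← hDm] at hQ hloc ⊢
  have he : e ≤ C * e := by
    calc e = 1 * e := (one_mul e).symm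
      _ ≤ C * e := by gcongr; exact_mod_cast hC1
  have hone : ∀ c : ℕ, 1 ≤ c → 1 ≤ c ^ d := fun c hc => Nat.one_le_pow _ _ hc
  have hdiff : ∀ {t t'}, t' ≤ m → D t' \ D t ⊆ D m \ dyadic J β := fun ht =>
    Set.sdiff_subset_sdiff (hmono ht) (dyadic_subset_neighborhood _ β)
  -- One generation: `D (t + 1)` has sides at most `6 * 2 ^ t`, and each cell of side `2 ^ t` takes
  -- its own polynomial.
  have hstep : ∀ t, t + 1 ≤ m → Approximable l q f (C * e) (D (t + 1) \ D t) (6 ^ d) := by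
    intro t ht
    have hsub := hdiff (t := t) ht
    have h1 := neighborhood_eq_gridSet (Nat.le_succ t) ht hm β
    have h2 := neighborhood_eq_gridSet le_rfl ((Nat.le_succ t).trans ht) hm β
    simp only [hD] at hsub ⊢
    simp only [Nat.succ_eq_add_one] at h1
    rw [h1, h2, ← gridSet_sdiff] at hsub ⊢
    refine (hloc.approximable_gridSet hq he hsub (Set.sdiff_subset.trans hQ)).mono ?_
    refine (Finset.card_le_card Finset.sdiff_subset).trans
      (card_neighborhood_le (Nat.le_succ t) ht ?_ β)
    rw [Nat.succ_eq_add_one, pow_succ]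
    omega
  have hring : ∀ t t', t ≤ t' → t' ≤ m → touchedFaces m t' β = touchedFaces m t β →
      Approximable l q f (C * e) (D t' \ D t) M₀ := by
    intro t t' htt htm hfaces
    rcases Nat.lt_or_ge t' (t + 2) with hlt | hge
    · rcases (by omega : t' = t ∨ t' = t + 1) with rfl | rfl
      · rw [Set.sdiff_self]
        exact approximable_empty.mono (Nat.zero_le _)
      · exact (hstep t htm).mono (by omega)
    · have hpow : (4 : ℝ) * 2 ^ t ≤ 2 ^ t' := by
        calc (4 : ℝ) * 2 ^ t = 2 ^ (t + 2) := by rw [pow_add]; ring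
          _ ≤ 2 ^ t' := pow_le_pow_right₀ (by norm_num) hge
      have hpt : (0 : ℝ) < 2 ^ t := by positivity
      have hJ : (0 : ℝ) < 2 ^ J := by positivity
      -- The unit `r` is a quarter of the cell of generation `t'`: the outer sides lie between `4 r`
      -- and `12 r`, the inner ones are at most `3 r` because `t + 2 ≤ t'`, and untouched faces are
      -- at distance at least `2 ^ t' - 2 ^ t ≥ 3 r` (in units of `2 ^ (-J)`).
      obtain ⟨P, hP, hPe⟩ := hC q hq f hf e (2 ^ t' / 4 / 2 ^ J) (by positivity)
        (fun i => (lowEnd m t' (β i) : ℝ) / 2 ^ J) (fun i => (highEnd m t' (β i) : ℝ) / 2 ^ J)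
        (fun i => (lowEnd m t (β i) : ℝ) / 2 ^ J) (fun i => (highEnd m t (β i) : ℝ) / 2 ^ J)
        (fun i => by
          have h1 := lowEnd_le_dyadicFloor (β i) htm
          have h2 := dyadicFloor_add_le_highEnd (β i) htm
          have h3 : (lowEnd m t' (β i) : ℝ) + 2 ^ t' ≤ highEnd m t' (β i) := by
            exact_mod_cast (add_le_add_left h1 _).trans h2
          rw [mul_div_assoc', ← add_div]
          gcongr
          linarith)
        (fun i => by
          have h3 : (highEnd m t' (β i) : ℝ) ≤ lowEnd m t' (β i) + 3 * 2 ^ t' := by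
            exact_mod_cast highEnd_le_lowEnd_add (β i)
          rw [mul_div_assoc', ← add_div]
          gcongr
          linarith)
        (fun i => by
          have h3 : (highEnd m t (β i) : ℝ) ≤ lowEnd m t (β i) + 3 * 2 ^ t := by
            exact_mod_cast highEnd_le_lowEnd_add (β i)
          rw [mul_div_assoc', ← add_div]
          gcongr
          linarith)
        (fun i => by
          have h1 := lowEnd_le_dyadicFloor (β i) (htt.trans htm)
          have h2 := dyadicFloor_add_le_highEnd (β i) (htt.trans htm)
          have h3 : (0 : ℤ) < 2 ^ t := by positivity
          gcongr
          linarith)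
        (fun i => by
          by_cases h : (i, false) ∈ touchedFaces m t β
          · left
            have h' := touchedFaces_mono htt β h
            rw [mem_touchedFaces_false] at h h'
            rw [h, h']
          · right
            rw [← hfaces, mem_touchedFaces_false] at h
            have h3 : (lowEnd m t' (β i) : ℝ) + (2 ^ t' - 2 ^ t) ≤ lowEnd m t (β i) := by
              exact_mod_cast lowEnd_far (β i) htt h
            rw [← add_div]
            gcongr
            linarith)
        (fun i => by
          by_cases h : (i, true) ∈ touchedFaces m t β
          · left
            have h' := touchedFaces_mono htt β h
            rw [mem_touchedFaces_true] at h h'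
            rw [h, h']
          · right
            rw [← hfaces, mem_touchedFaces_true] at h
            have h3 : (highEnd m t (β i) : ℝ) + (2 ^ t' - 2 ^ t) ≤ highEnd m t' (β i) := by
              exact_mod_cast highEnd_far (β i) htt h
            rw [← add_div]
            gcongr
            linarith)
        (hloc.mono (hdiff htm))
      have h1 := neighborhood_eq_gridSet le_rfl htm hm β
      have h2 := neighborhood_eq_gridSet le_rfl (htt.trans htm) hm β
      have hsub1 : D t' ⊆ unitCube d := (hmono htm).trans hQ
      have hsub2 : D t ⊆ D t' := hmono htt
      change LqNorm _ (D t' \ D t) q ≤ _ at hPe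
      simp only [hD] at hPe hsub1 hsub2 ⊢
      rw [h1] at hPe hsub1 hsub2 ⊢
      rw [h2] at hPe hsub2 ⊢
      refine approximable_gridSet_diff hq hsub1 hsub2 ?_ ?_ hP hPe
      · have := hone 6 (by norm_num)
        omega
      · have a1 := card_neighborhood_le (d := d) (c := 3) le_rfl htm le_rfl β
        have a2 := card_neighborhood_le (d := d) (c := 3) le_rfl (htt.trans htm) le_rfl β
        have : 3 ^ d ≤ 6 ^ d := Nat.pow_le_pow_left (by norm_num) d
        omega
  have hcard : ∀ t, (touchedFaces m t β).card ≤ 2 * d := fun t =>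
    (Finset.card_le_univ _).trans (by simp [mul_comm])
  have hunion : ∀ {S T : Set (Fin d → ℝ)}, S ⊆ T → T ⊆ D m → D m \ S = (D m \ T) ∪ (T \ S) := by
    intro S T hST hT
    ext x
    constructor
    · rintro ⟨h1, h2⟩
      by_cases h : x ∈ T
      exacts [Or.inr ⟨h, h2⟩, Or.inl ⟨h1, h⟩]
    · rintro (⟨h1, h2⟩ | ⟨h1, h2⟩)
      exacts [⟨h1, fun h => h2 (hST h)⟩, ⟨hT h1, h2⟩]
  have hdisj : ∀ S T : Set (Fin d → ℝ), Disjoint (D m \ T) (T \ S) := fun S T =>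
    Set.disjoint_left.2 fun x h1 h2 => h1.2 h2.1
  -- Descending induction from `m`. The index `t'` is the latest generation down to which everything
  -- outside has been treated; the touched faces have not changed since. The count is paid for by
  -- the faces lost so far.
  have hind : ∀ n ≤ m, ∃ t', m - n ≤ t' ∧ t' ≤ m ∧
      touchedFaces m t' β = touchedFaces m (m - n) β ∧
      Approximable l q f (C * e) (D m \ D t')
        ((2 * d - (touchedFaces m t' β).card) * (M₀ + 6 ^ d)) := by
    intro n
    induction n with
    | zero =>
      intro _
      refine ⟨m, by omega, le_rfl, by simp, ?_⟩
      rw [Set.sdiff_self]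
      exact approximable_empty.mono (Nat.zero_le _)
    | succ n ih =>
      intro hn
      obtain ⟨t', h1, h2, h3, h4⟩ := ih (by omega)
      obtain ⟨t, ht⟩ : ∃ t, m - n = t + 1 := ⟨m - n - 1, by omega⟩
      have ht' : m - (n + 1) = t := by omega
      rw [ht] at h1 h3
      rw [ht']
      by_cases hfaces : touchedFaces m (t + 1) β = touchedFaces m t β
      · exact ⟨t', by omega, h2, h3.trans hfaces, h4⟩
      · refine ⟨t, le_rfl, by omega, rfl, ?_⟩
        have hlt : (touchedFaces m t β).card < (touchedFaces m (t + 1) β).card :=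
          Finset.card_lt_card (lt_of_le_of_ne (touchedFaces_mono (Nat.le_succ t) β)
            (Ne.symm hfaces))
        have hA := h4.union (hring (t + 1) t' h1 h2 h3) (hdisj _ _)
          ((hmeas _).diff (hmeas _)) ((hmeas _).diff (hmeas _))
        rw [← hunion (hmono h1) (hmono h2)] at hA
        have hB := hA.union (hstep t (by omega)) (hdisj _ _)
          ((hmeas _).diff (hmeas _)) ((hmeas _).diff (hmeas _))
        rw [← hunion (hmono (Nat.le_succ t)) (hmono (by omega))] at hB
        refine hB.mono ?_
        have hc := hcard (t + 1)
        rw [h3, add_assoc]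
        calc _ = (2 * d - (touchedFaces m (t + 1) β).card + 1) * (M₀ + 6 ^ d) := by ring
          _ ≤ _ := Nat.mul_le_mul_right _ (by omega)
  obtain ⟨t', h1, h2, h3, h4⟩ := hind m le_rfl
  rw [Nat.sub_self] at h1 h3
  have hA := h4.union (hring 0 t' h1 h2 h3) (hdisj _ _)
    ((hmeas _).diff (hmeas _)) ((hmeas _).diff (hmeas _))
  rw [← hunion (hmono h1) (hmono h2)] at hA
  have hlast : Approximable l q f (C * e) (D 0 \ dyadic J β) (3 ^ d) := by
    have hsub : D 0 \ dyadic J β ⊆ D m \ dyadic J β :=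
      Set.sdiff_subset_sdiff (hmono (Nat.zero_le m)) le_rfl
    have h5 := neighborhood_eq_gridSet le_rfl (Nat.zero_le m) hm β
    rw [← gridSet_singleton]
    rw [← gridSet_singleton] at hsub
    simp only [hD] at hsub ⊢
    rw [h5, Nat.sub_zero, ← gridSet_sdiff] at hsub ⊢
    rw [gridSet_singleton] at hsub
    refine (hloc.approximable_gridSet hq he hsub (Set.sdiff_subset.trans hQ)).mono ?_
    exact (Finset.card_le_card Finset.sdiff_subset).trans
      (card_neighborhood_le le_rfl (Nat.zero_le m) le_rfl β)
  have hB := hA.union hlast (hdisj _ _)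
    ((hmeas _).diff (hmeas _)) ((hmeas _).diff (measurableSet_dyadic _ _))
  rw [← hunion (dyadic_subset_neighborhood _ β) (hmono (Nat.zero_le m))] at hB
  refine hB.mono ?_
  have : (2 * d - (touchedFaces m t' β).card) * (M₀ + 6 ^ d) ≤ 2 * d * (M₀ + 6 ^ d) :=
    Nat.mul_le_mul_right _ (Nat.sub_le _ _)
  omega

/-! ### Superadditivity of the variation -/

/-- The supremum of the sums `∑ E_k(f; Q; L_q)^p` over families of pairwise disjoint cubes
contained in `S`. -/
noncomputable def variationSum (k : ℕ) (p q : ℝ) (f : (Fin d → ℝ) → ℝ)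
    (S : Set (Fin d → ℝ)) : ℝ≥0∞ :=
  ⨆ Δ : {Δ : Set (Set (Fin d → ℝ)) // (∀ Q ∈ Δ, IsCube Q ∧ Q ⊆ S) ∧ Δ.PairwiseDisjoint id},
    ∑' Q : Δ.1, bestApprox k f (Q : Set (Fin d → ℝ)) q ^ p

section Variation

variable {k : ℕ} {p q : ℝ} {f : (Fin d → ℝ) → ℝ} {S S₁ S₂ : Set (Fin d → ℝ)}

theorem variationSum_le_variation_rpow (hp : 1 ≤ p) :
    variationSum k p q f S ≤ variation k p q f S ^ p := by
  have hp0 : 0 < p := by linarith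
  refine iSup_le fun Δ => ?_
  have h : (∑' Q : Δ.1, bestApprox k f (Q : Set (Fin d → ℝ)) q ^ p) ^ (1 / p) ≤
      variation k p q f S :=
    le_iSup_of_le Δ.1 (le_iSup_of_le Δ.2.1 (le_iSup_of_le Δ.2.2 le_rfl))
  calc _ = ((∑' Q : Δ.1, bestApprox k f (Q : Set (Fin d → ℝ)) q ^ p) ^ (1 / p)) ^ p := by
        rw [← ENNReal.rpow_mul, one_div_mul_cancel hp0.ne', ENNReal.rpow_one]
    _ ≤ _ := ENNReal.rpow_le_rpow h hp0.le

theorem cube_nonempty (a : Fin d → ℝ) {r : ℝ} (hr : 0 < r) : (cube a r).Nonempty :=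
  ⟨a, mem_cube.2 fun i => ⟨le_rfl, by linarith⟩⟩

theorem bestApprox_rpow_le_variationSum {a : Fin d → ℝ} {r : ℝ} (hr : 0 < r)
    (h : cube a r ⊆ S) : bestApprox k f (cube a r) q ^ p ≤ variationSum k p q f S := by
  refine le_iSup_of_le ⟨{cube a r}, ?_, Set.pairwiseDisjoint_singleton _ _⟩ ?_
  · intro Q hQ
    rw [Set.mem_singleton_iff.1 hQ]
    exact ⟨⟨a, r, hr, rfl⟩, h⟩
  · exact (tsum_singleton (cube a r)
      (fun Q : Set (Fin d → ℝ) => bestApprox k f Q q ^ p)).ge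

/-- Packings of two disjoint sets unite to a packing of any set containing both. Cubes are nonempty,
so no cube belongs to both families and the sums add. -/
theorem variationSum_add_le (hd : Disjoint S₁ S₂) (h₁ : S₁ ⊆ S) (h₂ : S₂ ⊆ S) :
    variationSum k p q f S₁ + variationSum k p q f S₂ ≤ variationSum k p q f S := by
  have hne : ∀ T : Set (Fin d → ℝ), Nonempty {Δ : Set (Set (Fin d → ℝ)) //
      (∀ Q ∈ Δ, IsCube Q ∧ Q ⊆ T) ∧ Δ.PairwiseDisjoint id} := fun T =>
    ⟨⟨∅, by simp, Set.pairwiseDisjoint_empty⟩⟩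
  have := hne S₁
  have := hne S₂
  refine ENNReal.iSup_add_iSup_le fun Δ₁ Δ₂ => ?_
  have hdisj : ∀ Q ∈ Δ₁.1, ∀ Q' ∈ Δ₂.1, Disjoint Q Q' := fun Q hQ Q' hQ' =>
    hd.mono (Δ₁.2.1 Q hQ).2 (Δ₂.2.1 Q' hQ').2
  have hΔ : Disjoint Δ₁.1 Δ₂.1 := by
    refine Set.disjoint_left.2 fun Q hQ hQ' => ?_
    obtain ⟨⟨a, r, hr, rfl⟩, -⟩ := Δ₁.2.1 Q hQ
    obtain ⟨x, hx⟩ := cube_nonempty a hr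
    exact Set.disjoint_left.1 (hdisj _ hQ _ hQ') hx hx
  refine le_iSup_of_le ⟨Δ₁.1 ∪ Δ₂.1, ?_, ?_⟩ ?_
  · rintro Q (hQ | hQ)
    · exact ⟨(Δ₁.2.1 Q hQ).1, (Δ₁.2.1 Q hQ).2.trans h₁⟩
    · exact ⟨(Δ₂.2.1 Q hQ).1, (Δ₂.2.1 Q hQ).2.trans h₂⟩
  · exact Δ₁.2.2.union Δ₂.2.2 fun Q hQ Q' hQ' _ => hdisj Q hQ Q' hQ'
  · exact (ENNReal.summable.tsum_union_disjoint
      (f := fun Q : Set (Fin d → ℝ) => bestApprox k f Q q ^ p) hΔ ENNReal.summable).ge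

theorem variationSum_mono (h : S₁ ⊆ S₂) : variationSum k p q f S₁ ≤ variationSum k p q f S₂ := by
  have := variationSum_add_le (k := k) (p := p) (q := q) (f := f)
    (Set.disjoint_empty S₁) h (Set.empty_subset S₂)
  exact le_self_add.trans this

theorem variationSum_empty : variationSum k p q f (∅ : Set (Fin d → ℝ)) = 0 := by
  refine le_antisymm (iSup_le fun Δ => ?_) zero_le
  have : IsEmpty Δ.1 := ⟨fun Q => by
    obtain ⟨⟨a, r, hr, hQ⟩, hQ'⟩ := Δ.2.1 Q.1 Q.2
    have := cube_nonempty a hr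
    rw [← hQ] at this
    exact (this.mono hQ').ne_empty rfl⟩
  simp

theorem sum_variationSum_le {ι : Type*} (s : Finset ι) {T : ι → Set (Fin d → ℝ)}
    (hT : ∀ i ∈ s, T i ⊆ S) (hd : ∀ i j, i ≠ j → Disjoint (T i) (T j)) :
    ∑ i ∈ s, variationSum k p q f (T i) ≤ variationSum k p q f S := by
  classical
  have key : ∑ i ∈ s, variationSum k p q f (T i) ≤ variationSum k p q f (⋃ i ∈ s, T i) := by
    clear hT
    induction s using Finset.induction_on with
    | empty => simp
    | insert a s ha ih =>
      rw [Finset.sum_insert ha, Finset.set_biUnion_insert]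
      refine (add_le_add le_rfl ih).trans
        (variationSum_add_le ?_ Set.subset_union_left Set.subset_union_right)
      rw [Set.disjoint_iUnion₂_right]
      intro i hi
      exact hd a i fun h => ha (h ▸ hi)
  exact key.trans (variationSum_mono (Set.iUnion₂_subset hT))

/-- A single cube is already a packing. The slack `e < e'` is needed because the infimum defining
`bestApprox` need not be known to be attained. -/
theorem locallyApproximable_of_variationSum (hp : 1 ≤ p) {e e' : ℝ≥0∞} (he : e < e')
    (h : variationSum k p q f S ≤ e ^ p) : LocallyApproximable (k - 1) q f e' S := by
  intro a r hr hs
  have hp0 : 0 < p := by linarith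
  have h1 : bestApprox k f (cube a r) q ≤ e :=
    (ENNReal.rpow_le_rpow_iff hp0).1 ((bestApprox_rpow_le_variationSum hr hs).trans h)
  have h2 := h1.trans_lt he
  unfold bestApprox at h2
  simp only [iInf_lt_iff] at h2
  obtain ⟨m, hm, hlt⟩ := h2
  exact ⟨m, hm, hlt.le⟩

end Variation

/-! ### Adaptive subdivision and counting -/

/-- The counting inequality for the subdivision of a heavy cube. -/
theorem sum_max_le {ι : Type*} [Fintype ι] {w x : ι → ℝ} {W M : ℝ} (hM : 0 ≤ M)
    (hw : ∀ i, 0 ≤ w i) (hsum : ∑ i, w i ≤ W) (hlt : ∀ i, w i ≤ W - 1) (hW : 1 ≤ W)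
    (hx : ∀ i, x i ≤ max 1 (2 * (M + Fintype.card ι) * w i - (M + Fintype.card ι))) :
    M + ∑ i, x i ≤ 2 * (M + Fintype.card ι) * W - (M + Fintype.card ι) := by
  classical
  set D : ℝ := (Fintype.card ι : ℝ) with hD
  have hD0 : 0 ≤ D := by positivity
  set B : ℝ := M + D with hB
  have hB0 : 0 ≤ B := by positivity
  have hx1 : ∀ i, x i ≤ 1 + 2 * B * w i := fun i =>
    (hx i).trans (max_le (by have := mul_nonneg hB0 (hw i); linarith)
      (by linarith))
  -- Call `i` heavy if `1 < x i`. With no heavy index, `W ≥ 1` suffices; with exactly one, the drop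
  -- `w i ≤ W - 1` gains `2 B`; with two or more, each of two heavy indices saves `B + 1` against
  -- the crude bound `1 + 2 * B * w`, so that superadditivity suffices.
  by_cases h0 : ∃ i, 1 < x i
  · obtain ⟨i, hi⟩ := h0
    have hbad : ∀ j, 1 < x j → x j ≤ 2 * B * w j - B := fun j hj => by
      rcases le_max_iff.1 (hx j) with h | h
      · linarith
      · exact h
    by_cases h1 : ∃ j, j ≠ i ∧ 1 < x j
    · obtain ⟨j, hji, hj⟩ := h1
      have hle : ∀ c, x c ≤ (1 + 2 * B * w c) - (if c = i then B + 1 else 0) -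
          (if c = j then B + 1 else 0) := by
        intro c
        by_cases hci : c = i
        · subst hci
          rw [if_pos rfl, if_neg (Ne.symm hji)]
          linarith [hbad c hi]
        · rw [if_neg hci]
          by_cases hcj : c = j
          · subst hcj
            rw [if_pos rfl]
            linarith [hbad c hj]
          · rw [if_neg hcj]
            linarith [hx1 c]
      have hs : ∑ c, x c ≤ (D + 2 * B * ∑ c, w c) - (B + 1) - (B + 1) := by
        refine (Finset.sum_le_sum fun c _ => hle c).trans (le_of_eq ?_)
        rw [Finset.sum_sub_distrib, Finset.sum_sub_distrib, Finset.sum_add_distrib,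
          ← Finset.mul_sum]
        simp [hD]
      have := mul_le_mul_of_nonneg_left hsum hB0
      linarith
    · push Not at h1
      have hle : ∀ c, x c ≤ 1 + (if c = i then x i - 1 else 0) := by
        intro c
        by_cases hci : c = i
        · subst hci; simp
        · rw [if_neg hci, add_zero]; exact h1 c hci
      have hs : ∑ c, x c ≤ D + (x i - 1) := by
        refine (Finset.sum_le_sum fun c _ => hle c).trans (le_of_eq ?_)
        rw [Finset.sum_add_distrib]
        simp [hD]
      have := mul_le_mul_of_nonneg_left (hlt i) hB0
      have := hbad i hi
      linarith
  · push Not at h0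
    have hs : ∑ c, x c ≤ D := by
      refine (Finset.sum_le_sum fun c _ => h0 c).trans (le_of_eq ?_)
      simp [hD]
    have := mul_le_mul_of_nonneg_left hW hB0
    linarith

/-- The indices of the `2 ^ d` dyadic children of a dyadic cube. -/
def child (β : Fin d → ℤ) (s : Fin d → Fin 2) : Fin d → ℤ := fun i => 2 * β i + (s i : ℕ)

theorem child_injective (β : Fin d → ℤ) : Function.Injective (child β) := by
  intro s s' h
  ext i
  have := congrFun h i
  simp only [child] at this
  omega

theorem child_ediv (β : Fin d → ℤ) (s : Fin d → Fin 2) (m : ℕ) (i : Fin d) :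
    child β s i / 2 ^ (m + 1) = β i / 2 ^ m := by
  rw [pow_succ', ← Int.ediv_ediv_of_nonneg (by norm_num)]
  congr 1
  have := (s i).isLt
  simp only [child]
  omega

theorem iUnion_dyadic_child (j : ℕ) (β : Fin d → ℤ) :
    ⋃ s ∈ (Finset.univ : Finset (Fin d → Fin 2)), dyadic (j + 1) (child β s) = dyadic j β := by
  ext x
  simp only [Finset.mem_univ, Set.iUnion_true, Set.mem_iUnion, mem_dyadic, funext_iff,
    Int.floor_eq_iff, child]
  push_cast
  constructor
  · rintro ⟨s, hs⟩ i
    have h1 := hs i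
    have h2 : ((s i : ℕ) : ℝ) ≤ 1 := by exact_mod_cast Nat.lt_succ_iff.1 (s i).isLt
    have h3 : (0 : ℝ) ≤ ((s i : ℕ) : ℝ) := by positivity
    rw [pow_succ, ← mul_assoc] at h1
    constructor <;> linarith
  · intro h
    refine ⟨fun i => if x i * 2 ^ j < β i + 1 / 2 then 0 else 1, fun i => ?_⟩
    have h1 := h i
    rw [pow_succ, ← mul_assoc]
    beta_reduce
    split_ifs with hc
    · simp only [Fin.val_zero, Nat.cast_zero]
      constructor <;> linarith
    · simp only [Fin.val_one, Nat.cast_one]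
      constructor <;> linarith

/-- The adaptive dyadic subdivision: the number of pieces is controlled by the variation. -/
theorem exists_approximable_dyadic {k M J : ℕ} {p q : ℝ} (hp : 1 ≤ p) (hq : 1 ≤ q)
    {f : (Fin d → ℝ) → ℝ} {C : NNReal} (hC : 1 ≤ C) {e e' : ℝ≥0∞} (he0 : e ≠ 0)
    (hetop : e ≠ ⊤) (he : e < e') (hV : variationSum k p q f (unitCube d) ≠ ⊤)
    (hring : ∀ (J m : ℕ) (β : Fin d → ℤ), m ≤ J →
      dyadic (J - m) (fun i => β i / 2 ^ m) ⊆ unitCube d →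
      LocallyApproximable (k - 1) q f e' (dyadic (J - m) (fun i => β i / 2 ^ m) \ dyadic J β) →
      Approximable (k - 1) q f (C * e') (dyadic (J - m) (fun i => β i / 2 ^ m) \ dyadic J β) M)
    (hJ : ∀ α : Fin d → ℤ, dyadic J α ⊆ unitCube d → LqNorm f (dyadic J α) q ≤ e')
    (n : ℕ) (hn : n ≤ J) (α : Fin d → ℤ) (hα : dyadic (J - n) α ⊆ unitCube d) :
    ∃ c : ℕ, Approximable (k - 1) q f (C * e') (dyadic (J - n) α) c ∧
      (c : ℝ) ≤ max 1 (2 * (M + (2 : ℝ) ^ d) *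
        ((variationSum k p q f (dyadic (J - n) α)).toReal / (e ^ p).toReal) -
          (M + (2 : ℝ) ^ d)) := by
  classical
  have hp0 : 0 < p := by linarith
  set τ : ℝ := (e ^ p).toReal with hτ
  have hep_top : e ^ p ≠ ⊤ := ENNReal.rpow_ne_top_of_nonneg hp0.le hetop
  have hτ0 : 0 < τ := ENNReal.toReal_pos
    (by simp [ENNReal.rpow_eq_zero_iff, he0, hetop]) hep_top
  have hCe : e' ≤ C * e' := by
    calc e' = 1 * e' := (one_mul e').symm
      _ ≤ C * e' := by gcongr; exact_mod_cast hC
  have hfin : ∀ S ⊆ unitCube d, variationSum k p q f S ≠ ⊤ := fun S hS =>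
    ne_top_of_le_ne_top hV (variationSum_mono hS)
  -- Strong induction, since one round jumps from `Q` to the children of `Q'`, which may lie many
  -- levels below.
  induction n using Nat.strong_induction_on generalizing α with
  | _ n ih =>
  set j := J - n with hj
  by_cases hgood : variationSum k p q f (dyadic j α) ≤ e ^ p
  · obtain ⟨P, hP, hPe⟩ := locallyApproximable_of_variationSum hp he hgood _ _
      (by positivity) (subset_refl (dyadic j α))
    exact ⟨1, approximable_dyadic hq hα hP (hPe.trans hCe), by simp⟩
  set w : ℝ := (variationSum k p q f (dyadic j α)).toReal / τ with hw
  have hgt : ∀ S ⊆ unitCube d, ¬ variationSum k p q f S ≤ e ^ p →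
      1 < (variationSum k p q f S).toReal / τ := by
    intro S hS h
    rw [lt_div_iff₀ hτ0, one_mul]
    exact (ENNReal.toReal_lt_toReal hep_top (hfin S hS)).2 (not_le.1 h)
  have hw1 : 1 < w := hgt _ hα hgood
  -- `β` is a descendant of `α` by `m` generations outside which the cube is light; the greatest
  -- such `m` up to level `J` gives `Q'`.
  let Pm : ℕ → Prop := fun m => ∃ β : Fin d → ℤ, (∀ i, β i / 2 ^ m = α i) ∧
    variationSum k p q f (dyadic j α \ dyadic (j + m) β) ≤ e ^ p
  have hP0 : Pm 0 := ⟨α, by simp, by simp [variationSum_empty]⟩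
  obtain ⟨β, hβα, hβV⟩ : Pm (Nat.findGreatest Pm n) :=
    Nat.findGreatest_spec (Nat.zero_le n) hP0
  have hmn : Nat.findGreatest Pm n ≤ n := Nat.findGreatest_le n
  have hmax : ∀ m', Nat.findGreatest Pm n < m' → m' ≤ n → ¬ Pm m' := fun m' h h' =>
    Nat.findGreatest_is_greatest h h'
  generalize Nat.findGreatest Pm n = m at hβα hβV hmn hmax
  have hring' := hring (j + m) m β (Nat.le_add_left m j)
  rw [Nat.add_sub_cancel, funext hβα] at hring'
  have hQQ' : dyadic (j + m) β ⊆ dyadic j α := by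
    have h1 := dyadic_subset_neighborhood (J := j + m) (m := m) m β
    rw [neighborhood_self (Nat.le_add_left m j), Nat.add_sub_cancel, funext hβα] at h1
    exact h1
  have hRing := hring' hα (locallyApproximable_of_variationSum hp he hβV)
  have hunion : dyadic j α = (dyadic j α \ dyadic (j + m) β) ∪ dyadic (j + m) β :=
    (Set.sdiff_union_of_subset hQQ').symm
  have hfinish : ∀ c, Approximable (k - 1) q f (C * e') (dyadic (j + m) β) c →
      Approximable (k - 1) q f (C * e') (dyadic j α) (M + c) := by
    intro c hc
    rw [hunion]
    exact hRing.union hc Set.disjoint_sdiff_left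
      ((measurableSet_dyadic _ _).diff (measurableSet_dyadic _ _)) (measurableSet_dyadic _ _)
  have hM0 : (0 : ℝ) ≤ M := by positivity
  have hD1 : (1 : ℝ) ≤ 2 ^ d := one_le_pow₀ (by norm_num)
  -- If `Q'` already has level `J`, the zero polynomial serves on it; otherwise its children are
  -- subdivided.
  rcases hmn.eq_or_lt with hmn' | hmn'
  · have hjm : j + m = J := by omega
    have hterm : Approximable (k - 1) q f (C * e') (dyadic (j + m) β) 1 := by
      refine approximable_dyadic hq (hQQ'.trans hα) (P := 0) (Submodule.zero_mem _) ?_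
      have := hJ β (hjm ▸ hQQ'.trans hα)
      rw [hjm]
      simpa using this.trans hCe
    refine ⟨M + 1, hfinish 1 hterm, le_max_of_le_right ?_⟩
    push_cast
    nlinarith
  · have hsub : ∀ s, dyadic (j + m + 1) (child β s) ⊆ dyadic (j + m) β := fun s => by
      rw [← iUnion_dyadic_child (j + m) β]
      exact Set.subset_biUnion_of_mem (u := fun s => dyadic (j + m + 1) (child β s))
        (Finset.mem_univ s)
    have hlevel : J - (n - m - 1) = j + m + 1 := by omega
    have hIH : ∀ s, ∃ c : ℕ,
        Approximable (k - 1) q f (C * e') (dyadic (j + m + 1) (child β s)) c ∧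
        (c : ℝ) ≤ max 1 (2 * (M + (2 : ℝ) ^ d) *
          ((variationSum k p q f (dyadic (j + m + 1) (child β s))).toReal / τ) -
            (M + (2 : ℝ) ^ d)) := by
      intro s
      have := ih (n - m - 1) (by omega) (by omega) (child β s)
      rw [hlevel] at this
      exact this ((hsub s).trans (hQQ'.trans hα))
    choose c hc hcle using hIH
    have hdisj : ∀ s s', s ≠ s' → Disjoint (dyadic (j + m + 1) (child β s))
        (dyadic (j + m + 1) (child β s')) := fun s s' h =>
      disjoint_dyadic fun h' => h (child_injective β h')
    have hchildren := Approximable.biUnion Finset.univ (fun s _ => hc s) hdisj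
      (fun s => measurableSet_dyadic _ _)
    rw [iUnion_dyadic_child] at hchildren
    refine ⟨_, hfinish _ hchildren, le_max_of_le_right ?_⟩
    have hcard : (Fintype.card (Fin d → Fin 2) : ℝ) = 2 ^ d := by simp
    have hsumV := sum_variationSum_le (k := k) (p := p) (q := q) (f := f) Finset.univ
      (fun s _ => (hsub s).trans hQQ') hdisj
    have key := sum_max_le (ι := Fin d → Fin 2) (M := (M : ℝ)) (W := w)
      (w := fun s => (variationSum k p q f (dyadic (j + m + 1) (child β s))).toReal / τ)
      (x := fun s => (c s : ℝ)) hM0 (fun s => by positivity) ?_ ?_ hw1.le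
      (by rw [hcard]; exact hcle)
    · rw [hcard] at key
      push_cast
      exact key
    · rw [← Finset.sum_div, hw]
      gcongr
      rw [← ENNReal.toReal_sum fun s _ => hfin _ ((hsub s).trans (hQQ'.trans hα))]
      exact ENNReal.toReal_mono (hfin _ hα) hsumV
    · intro s
      -- By maximality of `m`, removing any child of `Q'` leaves a heavy remainder; superadditivity
      -- then makes the normalised mass of that child at most `w - 1`.
      have hbig : ¬ variationSum k p q f (dyadic j α \ dyadic (j + m + 1) (child β s)) ≤ e ^ p :=
        fun h => hmax (m + 1) (Nat.lt_succ_self m) hmn'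
          ⟨child β s, fun i => (child_ediv β s m i).trans (hβα i), h⟩
      have hgt1 := hgt _ (Set.sdiff_subset.trans hα) hbig
      have hadd := variationSum_add_le (k := k) (p := p) (q := q) (f := f)
        (Set.disjoint_sdiff_left (s := dyadic (j + m + 1) (child β s)) (t := dyadic j α))
        Set.sdiff_subset ((hsub s).trans hQQ')
      have hadd' := ENNReal.toReal_mono (hfin _ hα) hadd
      rw [ENNReal.toReal_add (hfin _ (Set.sdiff_subset.trans hα))
        (hfin _ ((hsub s).trans (hQQ'.trans hα)))] at hadd'
      have := div_le_div_of_nonneg_right hadd' hτ0.le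
      rw [add_div] at this
      linarith

theorem dyadic_zero : dyadic 0 (0 : Fin d → ℤ) = unitCube d := by
  simp only [dyadic, unitCube, Pi.zero_apply, Int.cast_zero, pow_zero, div_one]
  rfl

/-- The `L_q` norms of `f ∈ L_q` over dyadic cubes of high level are uniformly small. -/
theorem exists_level_LqNorm_le (hd : 1 ≤ d) {q : ℝ} (hq : 1 ≤ q) {f : (Fin d → ℝ) → ℝ}
    (hf : MemLp f (ENNReal.ofReal q) (volume.restrict (unitCube d))) {e : ℝ≥0∞} (he : e ≠ 0) :
    ∃ J : ℕ, ∀ α : Fin d → ℤ, dyadic J α ⊆ unitCube d → LqNorm f (dyadic J α) q ≤ e := by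
  have hq0 : 0 < q := by linarith
  have hfin : ∫⁻ x, ‖f x‖ₑ ^ q ∂(volume.restrict (unitCube d)) ≠ ⊤ := by
    rw [← LqNorm_rpow hq]
    exact ENNReal.rpow_ne_top_of_nonneg hq0.le hf.2.ne
  have heq : e ^ q ≠ 0 := by
    simp [ENNReal.rpow_eq_zero_iff, he, hq0.not_gt]
  -- Absolute continuity of the integral of `|f|^q`.
  obtain ⟨δ, hδ, hδ'⟩ := exists_pos_setLIntegral_lt_of_measure_lt hfin heq
  obtain ⟨J, hJ⟩ := ENNReal.exists_inv_two_pow_lt hδ.ne'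
  refine ⟨J, fun α hα => ?_⟩
  have hvol : volume (dyadic J α) < δ := by
    have h1 : ENNReal.ofReal (1 / 2 ^ J) = 2⁻¹ ^ J := by
      rw [one_div, ← inv_pow, ENNReal.ofReal_pow (by norm_num),
        ENNReal.ofReal_inv_of_pos (by norm_num)]
      simp
    rw [dyadic, volume_cube, h1]
    refine lt_of_le_of_lt ?_ hJ
    refine pow_le_of_le_one zero_le (pow_le_one₀ zero_le (by simp)) (by omega)
  have h2 := hδ' (dyadic J α) (lt_of_le_of_lt (Measure.restrict_apply_le _ _) hvol)
  rw [Measure.restrict_restrict_of_subset hα, ← LqNorm_rpow hq] at h2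
  exact ((ENNReal.rpow_lt_rpow_iff hq0).1 h2).le

theorem mem_piecewisePolys_insert_unitCube [DecidableEq (Set (Fin d → ℝ))] {l : ℕ}
    {Δ : Finset (Set (Fin d → ℝ))} {g : (Fin d → ℝ) → ℝ} (hg : g ∈ piecewisePolys l Δ) :
    g ∈ piecewisePolys l (insert (unitCube d) Δ) := by
  have h0 : (fun _ => 0) ∈ piecewisePolys l {unitCube d} :=
    ⟨fun _ => 0, fun _ _ => Submodule.zero_mem _, by simp⟩
  have h1 := add_mem_piecewisePolys h0 hg
  rw [← Finset.insert_eq] at h1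
  convert! h1 using 1
  ext x
  rw [zero_add]

end BVApprox

/-! ### Choice of the threshold and conclusion -/

open BVApprox in
theorem proposition4p5 (d k : ℕ) (hd : 2 ≤ d) :
    ∃ C : ℝ, 0 < C ∧
      ∀ p q : ℝ, 1 ≤ p → p < q →
        0 < BVApprox.smoothness d p q → BVApprox.smoothness d p q ≤ k →
      ∀ f : (Fin d → ℝ) → ℝ, ContDiff ℝ ∞ f → BVApprox.MemV k p q f →
        BVApprox.variation k p q f (BVApprox.unitCube d) = 1 →
      ∀ N : ℕ, 1 ≤ N →
        ∃ (Δ : Finset (Set (Fin d → ℝ))) (g : (Fin d → ℝ) → ℝ),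
          (∀ K ∈ Δ, K ∈ BVApprox.dyadicCubes d) ∧
          BVApprox.unitCube d ⊆ (⋃ K ∈ Δ, K) ∧
          g ∈ BVApprox.piecewisePolys (k - 1) Δ ∧
          BVApprox.LqNorm (fun x => f x - g x) (BVApprox.unitCube d) q ≤
            ENNReal.ofReal (C * (N : ℝ) ^ (-(BVApprox.smoothness d p q) / d)) ∧
          Δ.card ≤ (2 ^ (d + 2) + 9) * N := by
  classical
  obtain ⟨C, M, hC, hM, hring⟩ := exists_approximable_dyadic_diff d (k - 1) hd
  set A : ℝ := 2 * (M + (2 : ℝ) ^ d) with hA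
  have hD1 : (1 : ℝ) ≤ 2 ^ d := one_le_pow₀ (by norm_num)
  have hM0 : (0 : ℝ) ≤ M := by positivity
  have hA1 : 1 ≤ A := by linarith
  have hC0 : (0 : ℝ) < C := lt_of_lt_of_le one_pos (by exact_mod_cast hC)
  refine ⟨C * (2 * A), by positivity, fun p q hp hpq _ _ f hf hfV hvar N hN => ?_⟩
  have hp0 : 0 < p := by linarith
  have hq : 1 ≤ q := by linarith
  have hq0 : 0 < q := by linarith
  have hN1 : (1 : ℝ) ≤ N := by exact_mod_cast hN
  have hN0 : (0 : ℝ) < N := by linarith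
  -- The threshold `r ^ p = A / N` turns the bound `A * V / r ^ p` on the number of pieces into `N *
  -- V`, where `V ≤ 1`.
  set r : ℝ := (A / N) ^ (1 / p) with hr
  have hr0 : 0 < r := Real.rpow_pos_of_pos (by positivity) _
  have hrp : r ^ p = A / N := by
    rw [hr, ← Real.rpow_mul (by positivity), one_div_mul_cancel hp0.ne', Real.rpow_one]
  have hV1 : variationSum k p q f (unitCube d) ≤ 1 := by
    refine (variationSum_le_variation_rpow hp).trans ?_
    rw [hvar, ENNReal.one_rpow]
  have he2 : ENNReal.ofReal r < ENNReal.ofReal (2 * r) :=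
    (ENNReal.ofReal_lt_ofReal_iff (by positivity)).2 (by linarith)
  obtain ⟨J, hJ⟩ := exists_level_LqNorm_le (by omega) hq hfV.1
    (e := ENNReal.ofReal (2 * r)) (by simpa using hr0)
  obtain ⟨c, ⟨g, ⟨Δ, hΔ, hcard, hg⟩, -, hbound⟩, hc⟩ := exists_approximable_dyadic (M := M) hp hq hC
    (by simpa using hr0) ENNReal.ofReal_ne_top he2 (ne_top_of_le_ne_top ENNReal.one_ne_top hV1)
    (fun J m β => hring q hq f hf.continuous _ J m β) hJ J le_rfl 0
    (by rw [Nat.sub_self, dyadic_zero])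
  rw [Nat.sub_self, dyadic_zero] at hbound hc
  have hcN : c ≤ N := by
    have hτ : (ENNReal.ofReal r ^ p).toReal = A / N := by
      rw [ENNReal.ofReal_rpow_of_pos hr0, hrp, ENNReal.toReal_ofReal (by positivity)]
    have hV2 : (variationSum k p q f (unitCube d)).toReal ≤ 1 := by
      simpa using ENNReal.toReal_mono ENNReal.one_ne_top hV1
    have h2 : A * ((variationSum k p q f (unitCube d)).toReal / (A / N)) ≤ N := by
      calc _ ≤ A * (1 / (A / N)) := by gcongr
        _ = N := by field_simp
    rw [hτ] at hc
    have : (c : ℝ) ≤ N := hc.trans (max_le hN1 (by linarith))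
    exact_mod_cast this
  -- The pieces need not cover the unit cube, so the whole cube is added with zero polynomial; the
  -- cardinality stays at most `N + 1 ≤ 2 N`.
  refine ⟨insert (unitCube d) Δ, g, ?_, ?_, mem_piecewisePolys_insert_unitCube hg, ?_, ?_⟩
  · intro K hK
    rcases Finset.mem_insert.1 hK with rfl | hK
    · exact ⟨subset_rfl, 0, 0, dyadic_zero.symm⟩
    · exact hΔ K hK
  · exact Set.subset_biUnion_of_mem (u := fun K : Set (Fin d → ℝ) => K)
      (Finset.mem_insert_self _ _)
  · rw [← ENNReal.rpow_le_rpow_iff hq0, LqNorm_rpow hq]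
    have hCe : (C : ℝ≥0∞) * ENNReal.ofReal (2 * r) = ENNReal.ofReal (C * (2 * r)) := by
      rw [ENNReal.ofReal_mul hC0.le, ENNReal.ofReal_coe_nnreal]
    have hexp : -(smoothness d p q) / d = 1 / q - 1 / p := by
      have : (d : ℝ) ≠ 0 := by
        have : 0 < d := by omega
        positivity
      unfold smoothness
      field_simp
      ring
    -- Since `A ≥ 1` and `p ≥ 1`, the factor `A ^ (1 / p)` is at most `A`, which keeps the constant
    -- independent of `p`.
    have hrle : r ≤ A * (N : ℝ) ^ (-(1 / p)) := by
      rw [hr, Real.div_rpow (by positivity) hN0.le, Real.rpow_neg hN0.le, div_eq_mul_inv]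
      gcongr
      exact (Real.rpow_le_rpow_of_exponent_le hA1 ((div_le_one hp0).2 hp)).trans_eq
        (Real.rpow_one A)
    calc _ ≤ (c : ℝ≥0∞) * (C * ENNReal.ofReal (2 * r)) ^ q := hbound
      _ ≤ (N : ℝ≥0∞) * (C * ENNReal.ofReal (2 * r)) ^ q := by gcongr
      _ = ENNReal.ofReal (N * (C * (2 * r)) ^ q) := by
        rw [hCe, ENNReal.ofReal_rpow_of_pos (by positivity), ENNReal.ofReal_mul hN0.le,
          ENNReal.ofReal_natCast]
      _ ≤ ENNReal.ofReal ((C * (2 * A) * (N : ℝ) ^ (-(smoothness d p q) / d)) ^ q) := by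
        refine ENNReal.ofReal_le_ofReal ?_
        have h3 : (N : ℝ) = ((N : ℝ) ^ (1 / q)) ^ q := by
          rw [← Real.rpow_mul hN0.le, one_div_mul_cancel hq0.ne', Real.rpow_one]
        have hle : (N : ℝ) ^ (1 / q) * (C * (2 * r)) ≤
            C * (2 * A) * (N : ℝ) ^ (1 / q - 1 / p) := by
          rw [sub_eq_add_neg, Real.rpow_add hN0]
          calc _ ≤ (N : ℝ) ^ (1 / q) * (C * (2 * (A * (N : ℝ) ^ (-(1 / p))))) := by gcongr
            _ = _ := by ring
        rw [hexp]
        calc _ = ((N : ℝ) ^ (1 / q) * (C * (2 * r))) ^ q := by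
              rw [Real.mul_rpow (x := (N : ℝ) ^ (1 / q)) (by positivity) (by positivity), ← h3]
          _ ≤ _ := Real.rpow_le_rpow (by positivity) hle hq0.le
      _ = _ := by rw [ENNReal.ofReal_rpow_of_pos (by positivity)]
  · have h1 := (Finset.card_insert_le (unitCube d) Δ)
    calc _ ≤ N + N := by omega
      _ ≤ (2 ^ (d + 2) + 9) * N := by nlinarith [Nat.zero_le (2 ^ (d + 2) * N)]
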